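/- Let $\sigma$ be a substitution on a finite alphabet $\mathcal A$, i.e. an endomorphism of the free monoid $\mathcal A^*$ such that $\sigma(a)$ is non-empty for every letter $a$ and $|\sigma^k(a)|\to\infty$ for at least one letter $a$. Let $M_\sigma$ be its incidence matrix, $(M_\sigma)_{a,b}=|\sigma(b)|_a$ (the number of occurrences of $a$ in $\sigma(b)$). Assume that $\sigma$ is an irreducible Pisot substitution: the dominant eigenvalue $\alpha$ of $M_\sigma$ is a Pisot number (a real algebraic integer $\alpha>1$ all of whose other conjugates have modulus less than $1$) and the characteristic polynomial of $M_\sigma$ is irreducible over $\mathbb Q$. Let $K=\mathbb Q(\alpha)\subset\mathbb R$ and let $\mathfrak p_1$ be the infinite prime of $K$ given by this inclusion. Let $$K_\sigma=\prod_{\mathfrak p\mid\infty,\ \mathfrak p\neq\mathfrak p_1}K_{\mathfrak p}\times\prod_{\mathfrak p\mid(\alpha)}K_{\mathfrak p}$$ be the product of the completions of $K$ at the other infinite primes and at the finite primes dividing $(\alpha)$, let $\Phi':K\to K_\sigma$ be the diagonal embedding, and let $\mu$ be a Haar measure on $K_\sigma$. Let $\mathbf v=(v_a)_{a\in\mathcal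 A}$ be a left eigenvector of $M_\sigma$ for $\alpha$ with positive entries in $K$. For a word $p$ put $\delta(p)=\sum_{a\in\mathcal A}|p|_a v_a$. Write $b\xrightarrow{p}a$ if $\sigma(b)=pas$ for some word $s$. For $a\in\mathcal A$ and $k\ge 0$ let $\mathbb Z_{\sigma,a}^{(k)}\subset K\subset\mathbb R$ be the set of all sums $\sum_{i=0}^{k-1}\delta(p_i)\alpha^i$ over the walks $a_k\xrightarrow{p_{k-1}}\cdots\xrightarrow{p_1}a_1\xrightarrow{p_0}a$. Let $\mathbb Z_{\sigma,a}\subset K$ be the topological (Kuratowski) limit in $\mathbb R$ of the sets $\mathbb Z_{\sigma,a}^{(k)}$ as $k\to\infty$, which exists, and let $\mathcal R_\sigma(a)=\overline{\Phi'(\mathbb Z_{\sigma,a})}\subset K_\sigma$. Let $V$ be the $\mathbb Z$-module generated by the $v_a$, and $$\Gamma=\{(\Phi'(x),a)\in K_\sigma\times\mathcal A:\ x\in V\cdot\mathbb Z[\alpha^{-1}],\ 0\le x<\delta(a)\}.$$ Then the collection $\{\mathcal R_\sigma(a)+\gamma:(\gamma,a)\in\Gamma\}$, indexed by $\Gamma$,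 is a multiple tiling of $K_\sigma$: each $\mathcal R_\sigma(a)+\gamma$ with $(\gamma,a)\in\Gamma$ is compact and is the closure of its interior, and there is a positive integer $m$ such that for $\mu$-almost every $z\in K_\sigma$ there are exactly $m$ pairs $(\gamma,a)\in\Gamma$ with $z\in\mathcal R_\sigma(a)+\gamma$. -/

import Mathlib

open scoped NumberField IntermediateField
open IsDedekindDomain NumberField MeasureTheory Filter Topology

noncomputable section

/-! ### Substitutions -/

/-- A substitution on the alphabet `A`: an endomorphism of the free monoid of finite words, given by
the images of the letters, such that all these images are non-empty and the iterates on at least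
one letter have lengths tending to infinity. -/
structure WordSubstitution (A : Type*) where
  /-- the image of a letter -/
  toFun : A → List A
  image_ne_nil : ∀ a, toFun a ≠ []
  growth : ∃ a, Tendsto (fun k : ℕ => ((fun w : List A => w.flatMap toFun)^[k] [a]).length)
    atTop atTop

/-- The incidence matrix: the `(a, b)` entry is the number of occurrences of `a` in `σ(b)`. -/
def WordSubstitution.incidence {A : Type*} [DecidableEq A] (σ : WordSubstitution A) :
    Matrix A A ℤ :=
  Matrix.of fun a b => ((σ.toFun b).count a : ℤ)

/-- The edges `a --p--> b` of the prefix automaton: `σ(a) = p b s` for some word `s`. -/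
def WordSubstitution.PrefixEdge {A : Type*} (σ : WordSubstitution A) (a : A) (p : List A) (b : A) :
    Prop :=
  ∃ s : List A, σ.toFun a = p ++ b :: s

/-- A Pisot number: a real algebraic integer `α > 1` all of whose other algebraic conjugates have
modulus less than `1`. -/
structure IsPisotNumber (α : ℝ) : Prop where
  one_lt : 1 < α
  isIntegral : IsIntegral ℤ α
  conjugates : ∀ β : ℂ, Polynomial.aeval β (minpoly ℚ α) = 0 → β ≠ (α : ℂ) → ‖β‖ < 1

/-- `α` is the dominant (that is, Perron--Frobenius) eigenvalue of the square matrix `M`: it is an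
eigenvalue and no complex eigenvalue of `M` has larger modulus. -/
def IsDominantEigenvalue {A : Type*} [Fintype A] [DecidableEq A] (M : Matrix A A ℤ) (α : ℝ) :
    Prop :=
  (α : ℂ) ∈ spectrum ℂ (M.map (Int.cast : ℤ → ℂ)) ∧
    ∀ β ∈ spectrum ℂ (M.map (Int.cast : ℤ → ℂ)), ‖β‖ ≤ α

/-- A Pisot substitution, together with the dominant eigenvalue `root` of its incidence matrix,
which is a Pisot number. (`root` is determined by the substitution.) -/
structure PisotSubstitution (A : Type*) [Fintype A] [DecidableEq A] extends WordSubstitution A where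
  root : ℝ
  root_dominant : IsDominantEigenvalue toWordSubstitution.incidence root
  root_pisot : IsPisotNumber root

/-! ### Topological limits -/

/-- The lower topological limit of a sequence of sets. -/
def topologicalLiminf {X : Type*} [TopologicalSpace X] (S : ℕ → Set X) : Set X :=
  {x | ∀ U ∈ 𝓝 x, ∀ᶠ k in atTop, (U ∩ S k).Nonempty}

/-- The upper topological limit of a sequence of sets. -/
def topologicalLimsup {X : Type*} [TopologicalSpace X] (S : ℕ → Set X) : Set X :=
  {x | ∀ U ∈ 𝓝 x, ∃ᶠ k in atTop, (U ∩ S k).Nonempty}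

/-- `L` is the topological limit of the sequence of sets `S`: the lower and the upper topological
limit both equal `L`. -/
def IsTopologicalLimit {X : Type*} [TopologicalSpace X] (S : ℕ → Set X) (L : Set X) : Prop :=
  topologicalLiminf S = L ∧ topologicalLimsup S = L

/-! ### Multiple tilings -/

/-- The family `T` of sets is a multiple tiling of `X` with respect to the measure `μ`: its members
are compact, each is the closure of its interior, and for some positive integer `m` almost every
point belongs to exactly `m` members of the family (counted by their indices). -/
def IsMultipleTiling {X : Type*} [TopologicalSpace X] [MeasurableSpace X] (μ : Measure X)
    {ι : Type*} (T : ι → Set X) : Prop :=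
  (∀ i, IsCompact (T i) ∧ T i = closure (interior (T i))) ∧
    ∃ m : ℕ, 0 < m ∧ ∀ᵐ x ∂μ, {i | x ∈ T i}.encard = m

namespace PisotSubstitution

variable {A : Type*} [Fintype A] [DecidableEq A] (σ : PisotSubstitution A)

/-- A Pisot substitution is irreducible if the characteristic polynomial of its incidence matrix is
irreducible over `ℚ`. -/
def IsIrreducible : Prop :=
  Irreducible (σ.incidence.map (Int.cast : ℤ → ℚ)).charpoly

/-! ### The number field and the representation space -/

/-- The number field `K = ℚ(α) ⊆ ℝ` generated by the Pisot root `α`. -/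
abbrev K : IntermediateField ℚ ℝ := ℚ⟮σ.root⟯

instance : NumberField σ.K where
  to_charZero := inferInstance
  to_finiteDimensional := IntermediateField.adjoin.finiteDimensional
    (σ.root_pisot.isIntegral.tower_top)

/-- The Pisot root as an element of `K`. -/
def α : σ.K := IntermediateField.AdjoinSimple.gen ℚ σ.root

theorem isIntegral_α : IsIntegral ℤ σ.α := by
  have h : algebraMap σ.K ℝ σ.α = σ.root := IntermediateField.AdjoinSimple.algebraMap_gen ℚ σ.root
  exact (isIntegral_algebraMap_iff (algebraMap σ.K ℝ).injective).1 (h ▸ σ.root_pisot.isIntegral)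

/-- The Pisot root as an element of the ring of integers of `K`. -/
def αInt : 𝓞 σ.K := ⟨σ.α, σ.isIntegral_α⟩

/-- The infinite prime `𝔭₁`, given by the inclusion `K ⊆ ℝ`, for which `|α| = α`. -/
def p₁ : InfinitePlace σ.K :=
  InfinitePlace.mk ((algebraMap ℝ ℂ).comp (algebraMap σ.K ℝ))

/-- The infinite primes of `K` other than `𝔭₁`. -/
abbrev InfPrimes : Type := {w : InfinitePlace σ.K // w ≠ σ.p₁}

/-- The finite primes of `K` that divide the principal ideal `(α)`. -/
abbrev FinPrimes : Type :=
  {𝔭 : HeightOneSpectrum (𝓞 σ.K) // 𝔭.asIdeal ∣ Ideal.span {σ.αInt}}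

/-- The representation space: the product of the completions of `K` at all infinite primes other
than `𝔭₁` and at all finite primes dividing `(α)`. -/
abbrev RepSpace : Type :=
  (∀ w : σ.InfPrimes, w.1.Completion) × (∀ 𝔭 : σ.FinPrimes, 𝔭.1.adicCompletion σ.K)

/-- The diagonal embedding of `K` into the representation space. -/
def Φ' : σ.K →+* σ.RepSpace :=
  RingHom.prod (RingHom.pi fun w => algebraMap σ.K w.1.Completion)
    (RingHom.pi fun 𝔭 => algebraMap σ.K (𝔭.1.adicCompletion σ.K))

/-! ### Dumont--Thomas numeration -/

/-- `v` is a left eigenvector of the incidence matrix for the eigenvalue `α`, scaled so that its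
entries are positive elements of `K = ℚ(α)`. -/
def IsPositiveLeftEigenvector (v : A → σ.K) : Prop :=
  Matrix.vecMul v (σ.incidence.map (Int.cast : ℤ → σ.K)) = σ.α • v ∧ ∀ a, 0 < (v a : ℝ)

variable (v : A → σ.K)

/-- `δ(p) = ⟨P(p), v⟩`, where `P(p)` counts the occurrences of each letter in the word `p`. -/
def δ (p : List A) : σ.K := ∑ a, (p.count a : σ.K) * v a

/-- The set of the sums `∑_{i < k} δ(p_i) α^i` over all walks
`a_k --p_{k-1}--> ⋯ --p_1--> a_1 --p_0--> a_0 = a` of length `k` in the prefix automaton. -/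
def approxIntegers (a : A) (k : ℕ) : Set σ.K :=
  {x | ∃ (w : ℕ → A) (p : ℕ → List A), w 0 = a ∧
    (∀ i < k, σ.PrefixEdge (w (i + 1)) (p i) (w i)) ∧
    x = ∑ i ∈ Finset.range k, σ.δ v (p i) * σ.α ^ i}

/-- The `(σ, a)`-integers: the elements of the topological limit in `ℝ` of the sets
`approxIntegers`. That this limit exists, and is contained in `K`, is proved in
`isTopologicalLimit_sigmaIntegers`. -/
def sigmaIntegers (a : A) : Set σ.K :=
  {x | (x : ℝ) ∈ topologicalLiminf
    fun k => (fun y : σ.K => (y : ℝ)) '' σ.approxIntegers v a k}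

/-- The `ℤ`-module `V = ⟨v_a : a ∈ A⟩`. -/
def V : Submodule ℤ σ.K := Submodule.span ℤ (Set.range v)

/-- The `(σ, a)`-fractional parts `V · ℤ[α⁻¹] ∩ [0, δ(a))`. -/
def Frac (a : A) : Set σ.K :=
  {x | x ∈ σ.V v * Subalgebra.toSubmodule (Algebra.adjoin ℤ {σ.α⁻¹}) ∧
    0 ≤ (x : ℝ) ∧ (x : ℝ) < (σ.δ v [a] : ℝ)}

/-! ### Subtiles and the translation set -/

/-- The Dumont--Thomas subtile of the letter `a`. -/
def subtile (a : A) : Set σ.RepSpace := closure (σ.Φ' '' σ.sigmaIntegers v a)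

/-- The translation set `Γ`. -/
def Γ : Set (σ.RepSpace × A) :=
  {g | ∃ x ∈ σ.Frac v g.2, g.1 = σ.Φ' x}

/-- The collection of the sets `R(a) + γ`, indexed by `(γ, a) ∈ Γ`. -/
def tile (g : σ.Γ v) : Set σ.RepSpace := (fun z => z + g.1.1) '' σ.subtile v g.1.2

/-! ### Existence of the topological limit -/

variable {v}

theorem coe_α : ((σ.α : σ.K) : ℝ) = σ.root := IntermediateField.AdjoinSimple.coe_gen ℚ σ.root

theorem δ_nonneg (hv : ∀ a, 0 < (v a : ℝ)) (p : List A) : 0 ≤ (σ.δ v p : ℝ) := by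
  simp only [δ]
  push_cast
  exact Finset.sum_nonneg fun a _ => mul_nonneg (Nat.cast_nonneg _) (hv a).le

theorem le_δ (hv : ∀ a, 0 < (v a : ℝ)) {p : List A} {a : A} (ha : a ∈ p) :
    (v a : ℝ) ≤ (σ.δ v p : ℝ) := by
  simp only [δ]
  push_cast
  refine le_trans ?_ (Finset.single_le_sum (f := fun b => (p.count b : ℝ) * (v b : ℝ))
    (fun b _ => mul_nonneg (Nat.cast_nonneg _) (hv b).le) (Finset.mem_univ a))
  have : (1 : ℝ) ≤ (p.count a : ℝ) := by exact_mod_cast List.count_pos_iff.2 ha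
  nlinarith [hv a]

theorem finite_approxIntegers (k : ℕ) : ∀ a, (σ.approxIntegers v a k).Finite := by
  induction k with
  | zero =>
    intro a
    refine (Set.finite_singleton (0 : σ.K)).subset ?_
    rintro x ⟨w, p, -, -, rfl⟩
    simp
  | succ k ih =>
    intro a
    refine (Set.finite_iUnion fun b : A => (List.finite_toSet (σ.toFun b).inits).biUnion
      fun q _ => (ih b).image fun y => y * σ.α + σ.δ v q).subset ?_
    rintro x ⟨w, p, h0, hw, rfl⟩
    obtain ⟨s, hs⟩ := hw 0 (Nat.succ_pos k)
    refine Set.mem_iUnion.2 ⟨w 1, Set.mem_iUnion₂.2 ⟨p 0, ?_, ?_⟩⟩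
    · exact (List.mem_inits _ _).2 ⟨_, hs.symm⟩
    · refine ⟨_, ⟨fun i => w (i + 1), fun i => p (i + 1), rfl,
        fun i hi => hw (i + 1) (Nat.succ_lt_succ hi), rfl⟩, ?_⟩
      rw [Finset.sum_range_succ']
      simp [Finset.sum_mul, pow_succ, mul_assoc]

theorem isTopologicalLimit_sigmaIntegers (hv : σ.IsPositiveLeftEigenvector v) (a : A) :
    IsTopologicalLimit (fun k => (fun y : σ.K => (y : ℝ)) '' σ.approxIntegers v a k)
      ((fun y : σ.K => (y : ℝ)) '' σ.sigmaIntegers v a) := by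
  have hpos := hv.2
  have h1 : 1 < σ.root := σ.root_pisot.one_lt
  set S : ℕ → Set ℝ := fun k => (fun y : σ.K => (y : ℝ)) '' σ.approxIntegers v a k with hS
  -- beyond a suitable index, the approximations in a bounded interval decrease
  have key : ∀ l : ℝ, ∃ k₀, ∀ k ≥ k₀, S (k + 1) ∩ Set.Iic l ⊆ S k ∩ Set.Iic l := by
    intro l
    obtain ⟨c, hc0, hc⟩ : ∃ c : ℝ, 0 < c ∧ ∀ b, c ≤ (v b : ℝ) := by
      have : Nonempty A := ⟨a⟩
      obtain ⟨b, hb⟩ := Finite.exists_min fun b => (v b : ℝ)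
      exact ⟨_, hpos b, hb⟩
    obtain ⟨k₀, hk₀⟩ := pow_unbounded_of_one_lt (l / c) h1
    refine ⟨k₀, fun k hk => ?_⟩
    rintro x ⟨⟨y, ⟨w, p, h0, hw, rfl⟩, rfl⟩, hx⟩
    have hx' : ((∑ i ∈ Finset.range (k + 1), σ.δ v (p i) * σ.α ^ i : σ.K) : ℝ) ≤ l := hx
    have hnil : p k = [] := by
      by_contra hne
      obtain ⟨b, hb⟩ := List.exists_mem_of_ne_nil _ hne
      have hle := (hc b).trans (σ.le_δ hpos hb)
      have hpow : l / c < σ.root ^ k := hk₀.trans_le (pow_le_pow_right₀ h1.le hk)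
      rw [div_lt_iff₀ hc0] at hpow
      rw [Finset.sum_range_succ] at hx'
      push_cast at hx'
      rw [coe_α] at hx'
      have hsum : (0 : ℝ) ≤ ∑ i ∈ Finset.range k, (σ.δ v (p i) : ℝ) * σ.root ^ i :=
        Finset.sum_nonneg fun i _ => mul_nonneg (σ.δ_nonneg hpos _) (by positivity)
      have : σ.root ^ k * c ≤ (σ.δ v (p k) : ℝ) * σ.root ^ k := by
        rw [mul_comm]; exact mul_le_mul_of_nonneg_right hle (by positivity)
      linarith
    have hδ : σ.δ v (p k) = 0 := by simp [hnil, δ]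
    refine ⟨⟨_, ⟨w, p, h0, fun i hi => hw i (hi.trans k.lt_succ_self), rfl⟩, ?_⟩, hx⟩
    simp [Finset.sum_range_succ, hδ]
  have hfin : ∀ k, (S k).Finite := fun k => (σ.finite_approxIntegers k a).image _
  -- a point of the upper limit belongs to all but finitely many of the sets
  have hsup : ∀ x ∈ topologicalLimsup S, ∃ k₀, ∀ k ≥ k₀, x ∈ S k := by
    intro x hx
    obtain ⟨k₀, hk₀⟩ := key (x + 1)
    refine ⟨k₀, fun k hk => ?_⟩
    have hanti : ∀ j ≥ k, S j ∩ Set.Iic (x + 1) ⊆ S k ∩ Set.Iic (x + 1) := by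
      intro j hj
      induction j, hj using Nat.le_induction with
      | base => exact subset_rfl
      | succ j hj ih => exact (hk₀ j (le_trans hk hj)).trans ih
    have hcl : x ∈ closure (S k) := by
      rw [mem_closure_iff_nhds]
      intro U hU
      have hU' : U ∩ Set.Iic (x + 1) ∈ 𝓝 x := inter_mem hU (Iic_mem_nhds (lt_add_one x))
      obtain ⟨j, hj, y, hy, hyS⟩ := frequently_atTop.1 (hx _ hU') k
      exact ⟨y, hy.1, (hanti j hj ⟨hyS, hy.2⟩).1⟩
    rwa [(hfin k).isClosed.closure_eq] at hcl
  have hsub : topologicalLiminf S ⊆ topologicalLimsup S := fun x hx U hU => (hx U hU).frequently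
  have hinf : topologicalLimsup S ⊆ topologicalLiminf S := by
    intro x hx U hU
    obtain ⟨k₀, hk₀⟩ := hsup x hx
    exact eventually_atTop.2 ⟨k₀, fun k hk => ⟨x, mem_of_mem_nhds hU, hk₀ k hk⟩⟩
  have himg : topologicalLiminf S = (fun y : σ.K => (y : ℝ)) '' σ.sigmaIntegers v a := by
    ext x
    constructor
    · intro hx
      obtain ⟨k₀, hk₀⟩ := hsup x (hsub hx)
      obtain ⟨y, -, rfl⟩ := hk₀ k₀ le_rfl
      exact ⟨y, hx, rfl⟩
    · rintro ⟨y, hy, rfl⟩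
      exact hy
  exact ⟨himg, (hinf.antisymm hsub).trans himg⟩

end PisotSubstitution

end

noncomputable section

/-! Lift the problem to `ℝ × RepSpace`. Over each subtile `R(a)` put the box `[0, v_a) × R(a)`, and
translate the boxes by the vectors `(-y, Φ'(y))` with `y` in `L = V · ℤ[α⁻¹]`. On the slice `t = 0`
these boxes cut out exactly the given collection, so it suffices to show that the number of boxes
through a point (`indices`) is finite, positive and almost everywhere constant, there and then on
the slice.

Constancy is an ergodicity statement. The vectors `(-y, Φ'(y))` form a closed cocompact subgroup,
and the count is invariant under it. Multiplication by `α` preserves this subgroup and does not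
increase the count when passing from `g` to `αg` (`ncard_indices_mulα_le`), because subdividing a
box along the substitution produces an injection between the boxes. On the compact quotient
multiplication by `α` preserves Haar measure, so every level set `{n ≤ count}` is invariant mod null
sets. Since `α` contracts `{0} × RepSpace` (the Pisot condition and the choice of primes), the level
set is also invariant under translation by that subgroup, whose image in the quotient is dense
because `L` is dense in `ℝ`. Hence the level set is null or conull. Fubini and right-continuity of
the count in `t` transfer the constant to `t = 0`.

The arithmetic input is that `L` is discrete (`finite_setOf_mem_L`) and relatively dense
(`exists_mem_L_near`) in `ℝ × RepSpace`. The greedy Dumont–Thomas expansion and density of `Φ'(L ∩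
[0, ∞))` give the covering property, hence positivity. Covering and Baire give some subtile an
interior point; irreducibility makes the prefix automaton strongly connected, which spreads interior
to every subtile, and the graph-directed self-similarity makes it dense. -/

/-! ### Ergodicity from a contracted subgroup -/

/-- A Mautner-type argument on `G ⧸ Λ`: an almost invariant set is almost invariant under
translation by everything that the endomorphism contracts, and a set invariant under a dense set of
translations is trivial. -/
theorem MeasureTheory.null_or_conull_of_contracting_endomorphism {G : Type*} [AddCommGroup G]
    [TopologicalSpace G] [IsTopologicalAddGroup G] [PolishSpace G] [MeasurableSpace G]
    [BorelSpace G] (Λ : AddSubgroup G) (hΛ : IsClosed (Λ : Set G)) [CompactSpace (G ⧸ Λ)]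
    (φ : G →+ G) (hφ : Continuous φ) (hsurj : Function.Surjective φ) (hφΛ : ∀ x ∈ Λ, φ x ∈ Λ)
    {E : Set G} (hE : MeasurableSet E) (hEΛ : ∀ x ∈ E, ∀ l ∈ Λ, x + l ∈ E) (hφE : φ ⁻¹' E ⊆ E)
    {H : Set G} (hH : ∀ h ∈ H, Tendsto (fun n => φ^[n] h) atTop (𝓝 0))
    (hd : Dense {x | ∃ h ∈ H, ∃ l ∈ Λ, x = h + l})
    (μ : Measure G) [SFinite μ] [μ.IsAddLeftInvariant] : μ E = 0 ∨ μ Eᶜ = 0 := by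
  have := hΛ
  let π : G → G ⧸ Λ := fun x => (x : G ⧸ Λ)
  have hπ : Continuous π := QuotientAddGroup.continuous_mk
  have hπs : Function.Surjective π := QuotientAddGroup.mk_surjective
  let ν : Measure (G ⧸ Λ) := Measure.addHaar
  let E' : Set (G ⧸ Λ) := π '' E
  have hpre : π ⁻¹' E' = E := by
    refine Set.Subset.antisymm ?_ (Set.subset_preimage_image _ _)
    rintro x ⟨y, hy, hxy⟩
    have := hEΛ y hy (-y + x) (QuotientAddGroup.eq.1 hxy)
    simpa using this
  have hE' : MeasurableSet E' := by
    rw [measurableSet_quotient]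
    exact hpre ▸ hE
  let ψ : G ⧸ Λ →+ G ⧸ Λ := QuotientAddGroup.map Λ Λ φ hφΛ
  have hψπ : ∀ x, ψ (π x) = π (φ x) := fun x => rfl
  have hψ : Continuous ψ := by
    refine (QuotientAddGroup.isQuotientMap_mk (N := Λ)).continuous_iff.2 ?_
    exact hπ.comp hφ
  have hψs : Function.Surjective ψ := by
    intro y
    obtain ⟨x, rfl⟩ := hπs y
    obtain ⟨z, rfl⟩ := hsurj x
    exact ⟨π z, rfl⟩
  have hmp : MeasurePreserving ψ ν ν := AddMonoidHom.measurePreserving hψ hψs rfl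
  have hψE : ψ ⁻¹' E' =ᵐ[ν] E' := by
    have hsub : ψ ⁻¹' E' ⊆ E' := by
      intro y hy
      obtain ⟨x, rfl⟩ := hπs y
      have : x ∈ φ ⁻¹' E := by
        rw [← hpre]; exact hy
      rw [← hpre] at hφE
      exact hφE (by rw [hpre]; exact this)
    -- A one-sided inclusion suffices: both sets have the same finite measure.
    refine ae_eq_of_subset_of_measure_ge hsub ?_ ?_ (measure_ne_top _ _)
    · rw [hmp.measure_preimage hE'.nullMeasurableSet]
    · exact (hmp.measurable hE').nullMeasurableSet
  have hψn : ∀ n : ℕ, (ψ^[n]) ⁻¹' E' =ᵐ[ν] E' := by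
    intro n
    induction n with
    | zero => exact ae_eq_refl _
    | succ n ih =>
      rw [Function.iterate_succ, Set.preimage_comp]
      exact (hmp.quasiMeasurePreserving.preimage_ae_eq ih).trans hψE
  have hτ : ∀ h ∈ H, (fun y => π h +ᵥ y) ⁻¹' E' =ᵐ[ν] E' := by
    intro h hh
    rw [← measure_symmDiff_eq_zero_iff]
    have hlim : Tendsto (fun n : ℕ => ψ^[n] (π h)) atTop (𝓝 0) := by
      have h1 : ∀ n : ℕ, ψ^[n] (π h) = π (φ^[n] h) := by
        intro n
        induction n with
        | zero => rfl
        | succ n ih => rw [Function.iterate_succ_apply', ih, Function.iterate_succ_apply']; rfl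
      simp_rw [h1]
      have := (hπ.tendsto 0).comp (hH h hh)
      exact this
    let f : C((G ⧸ Λ) × (G ⧸ Λ), G ⧸ Λ) := ⟨fun p => p.1 + p.2, continuous_add⟩
    have hc : Tendsto (fun n : ℕ => f.curry (ψ^[n] (π h))) atTop (𝓝 (f.curry 0)) :=
      (f.curry.continuous.tendsto 0).comp hlim
    -- Translation acts continuously in measure, so the defect of invariance under `ψ^n(h)` tends to
    -- `0`; pulling back by `ψ^n` shows that this defect does not depend on `n`.
    have hconv := tendsto_measure_symmDiff_preimage_nhds_zero (μ := ν) (ν := ν) (s := E') hc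
      (Eventually.of_forall fun n => measurePreserving_add_left ν _)
      (measurePreserving_add_left ν 0) hE'.nullMeasurableSet (measure_ne_top _ _)
    have h0 : (f.curry 0 : G ⧸ Λ → G ⧸ Λ) ⁻¹' E' = E' := by
      ext y
      simp [f]
    rw [h0] at hconv
    have hconst : ∀ n : ℕ, ν (symmDiff ((f.curry (ψ^[n] (π h)) : G ⧸ Λ → G ⧸ Λ) ⁻¹' E') E') =
        ν (symmDiff ((fun y => π h +ᵥ y) ⁻¹' E') E') := by
      intro n
      have hmpn : MeasurePreserving (ψ^[n]) ν ν := hmp.iterate n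
      have hmeas : MeasurableSet ((f.curry (ψ^[n] (π h)) : G ⧸ Λ → G ⧸ Λ) ⁻¹' E') :=
        (f.curry (ψ^[n] (π h))).continuous.measurable hE'
      rw [← hmpn.measure_preimage (hmeas.symmDiff hE').nullMeasurableSet, Set.preimage_symmDiff]
      refine measure_congr (Filter.EventuallyEq.symmDiff ?_ (hψn n))
      have heq : ψ^[n] ⁻¹' ((f.curry (ψ^[n] (π h)) : G ⧸ Λ → G ⧸ Λ) ⁻¹' E') =
          (fun y => π h + y) ⁻¹' (ψ^[n] ⁻¹' E') := by
        ext y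
        have : ψ^[n] (π h + y) = ψ^[n] (π h) + ψ^[n] y := by
          exact iterate_map_add ψ n _ _
        simp [f, this]
      rw [heq]
      exact (measurePreserving_add_left ν (π h)).quasiMeasurePreserving.preimage_ae_eq (hψn n)
    simp_rw [hconst] at hconv
    exact tendsto_nhds_unique tendsto_const_nhds hconv
  have hconst : EventuallyConst E' (ae ν) := by
    refine aeconst_of_dense_setOfPred_preimage_vadd_ae (M := G ⧸ Λ) hE'.nullMeasurableSet ?_
    refine (hπs.denseRange.dense_image hπ hd).mono ?_
    rintro _ ⟨x, ⟨h, hh, l, hl, rfl⟩, rfl⟩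
    have : π (h + l) = π h := by
      refine (QuotientAddGroup.eq.2 ?_).symm
      simpa using hl
    rw [this]
    exact hτ h hh
  -- Fubini for `{(x, q) | π x + q ∈ B}`: every section at fixed `x` is null, hence so is some
  -- section at fixed `q = π g`, and that section is a translate of `π ⁻¹' B`.
  have hnull : ∀ B : Set (G ⧸ Λ), MeasurableSet B → ν B = 0 → μ (π ⁻¹' B) = 0 := by
    intro B hB h0
    have hadd : Measurable fun p : G × (G ⧸ Λ) => π p.1 + p.2 := by
      have : Continuous fun p : G × (G ⧸ Λ) => π p.1 + p.2 := by fun_prop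
      exact this.measurable
    have hS : MeasurableSet {p : G × (G ⧸ Λ) | π p.1 + p.2 ∈ B} := hadd hB
    have h1 : (μ.prod ν) {p : G × (G ⧸ Λ) | π p.1 + p.2 ∈ B} = 0 := by
      rw [Measure.measure_prod_null hS]
      refine Eventually.of_forall fun x => ?_
      have := measure_preimage_add ν (π x) B
      rw [h0] at this
      exact this
    have h2 : (ν.prod μ) (Prod.swap ⁻¹' {p : G × (G ⧸ Λ) | π p.1 + p.2 ∈ B}) = 0 := by
      rw [← Measure.measurePreserving_swap.measure_preimage hS.nullMeasurableSet] at h1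
      exact h1
    obtain ⟨q, hq⟩ := (Measure.measure_ae_null_of_prod_null h2).exists
    obtain ⟨g, rfl⟩ := hπs q
    rw [← measure_preimage_add μ g]
    refine (congrArg μ ?_).trans hq
    ext x
    simp [π, add_comm]
  rw [eventuallyConst_set'] at hconst
  rcases hconst with h | h
  · left
    rw [← hpre]
    exact hnull _ hE' (ae_eq_empty.1 h)
  · right
    rw [← hpre, ← Set.preimage_compl]
    exact hnull _ hE'.compl (ae_eq_univ.1 h)

/-- The superlevel sets cannot all be conull, as `f` is finite everywhere; the constant is one less
than the first `n` with a null superlevel set. -/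
theorem MeasureTheory.exists_ae_eq_of_forall_null_or_conull {X : Type*} [MeasurableSpace X]
    {μ : Measure X} [NeZero μ] (f : X → ℕ)
    (h : ∀ n, μ {x | n ≤ f x} = 0 ∨ μ {x | n ≤ f x}ᶜ = 0) : ∃ m, ∀ᵐ x ∂μ, f x = m := by
  have hex : ∃ n, μ {x | n ≤ f x} = 0 := by
    by_contra! hne
    have h1 : ∀ᵐ x ∂μ, ∀ n, n ≤ f x := ae_all_iff.2 fun n => (h n).resolve_left (hne n)
    obtain ⟨x, hx⟩ := h1.exists
    exact absurd (hx (f x + 1)) (by omega)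
  classical
  have h0 : Nat.find hex ≠ 0 := by
    intro h0
    have h1 := Nat.find_spec hex
    rw [h0] at h1
    simp at h1
    exact NeZero.ne μ h1
  obtain ⟨m, hm⟩ := Nat.exists_eq_succ_of_ne_zero h0
  refine ⟨m, ?_⟩
  have h1 : ∀ᵐ x ∂μ, ¬ (m + 1 ≤ f x) := by
    rw [ae_iff]
    simpa [hm] using Nat.find_spec hex
  have h2 : ∀ᵐ x ∂μ, m ≤ f x := (h m).resolve_left (Nat.find_min hex (by omega))
  filter_upwards [h1, h2] with x hx1 hx2
  omega

/-! ### Completions -/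

section Completions

variable {K : Type*} [Field K] [NumberField K]

instance (w : InfinitePlace K) : ProperSpace w.Completion := by
  have h := InfinitePlace.Completion.isometry_extensionEmbedding w
  refine ⟨fun x r => ?_⟩
  rw [← h.preimage_closedBall]
  exact h.isClosedEmbedding.isCompact_preimage (isCompact_closedBall _ _)

theorem IsDedekindDomain.HeightOneSpectrum.norm_algebraMap (𝔭 : HeightOneSpectrum (𝓞 K)) (x : K) :
    ‖algebraMap K (𝔭.adicCompletion K) x‖ =
      WithZeroMulInt.toNNReal (HeightOneSpectrum.absNorm_ne_zero 𝔭) (𝔭.valuation K x) :=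
  FinitePlace.norm_embedding' 𝔭 x

theorem IsDedekindDomain.HeightOneSpectrum.norm_algebraMap_le_iff (𝔭 : HeightOneSpectrum (𝓞 K))
    (x y : K) :
    ‖algebraMap K (𝔭.adicCompletion K) x‖ ≤ ‖algebraMap K (𝔭.adicCompletion K) y‖ ↔
      𝔭.valuation K x ≤ 𝔭.valuation K y := by
  rw [norm_algebraMap, norm_algebraMap, NNReal.coe_le_coe]
  exact (WithZeroMulInt.toNNReal_strictMono
    (HeightOneSpectrum.one_lt_absNorm_nnreal 𝔭)).le_iff_le

theorem IsDedekindDomain.HeightOneSpectrum.norm_add_le_max (𝔭 : HeightOneSpectrum (𝓞 K))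
    (x y : 𝔭.adicCompletion K) : ‖x + y‖ ≤ max ‖x‖ ‖y‖ := by
  simp only [FinitePlace.norm_def, ← NNReal.coe_max, NNReal.coe_le_coe]
  rw [← (WithZeroMulInt.toNNReal_strictMono
    (HeightOneSpectrum.one_lt_absNorm_nnreal 𝔭)).monotone.map_max]
  exact (WithZeroMulInt.toNNReal_strictMono
    (HeightOneSpectrum.one_lt_absNorm_nnreal 𝔭)).monotone (Valuation.map_add _ _ _)

/-- Global integers are dense in the ring of local integers. -/
theorem IsDedekindDomain.HeightOneSpectrum.exists_norm_sub_algebraMap_le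
    (𝔭 : HeightOneSpectrum (𝓞 K)) {z : 𝔭.adicCompletion K} (hz : ‖z‖ ≤ 1) {y : K} (hy : y ≠ 0) :
    ∃ r : 𝓞 K, ‖z - algebraMap K (𝔭.adicCompletion K) r‖ ≤
      ‖algebraMap K (𝔭.adicCompletion K) y‖ := by
  have hy' : 0 < ‖algebraMap K (𝔭.adicCompletion K) y‖ := by simpa using hy
  have hd : DenseRange (algebraMap K (𝔭.adicCompletion K)) :=
    HeightOneSpectrum.denseRange_algebraMap K 𝔭
  obtain ⟨k, hk⟩ := hd.exists_dist_lt z (lt_min hy' one_pos)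
  rw [dist_eq_norm] at hk
  have hk1 : ‖algebraMap K (𝔭.adicCompletion K) k‖ ≤ ‖algebraMap K (𝔭.adicCompletion K) 1‖ := by
    have h1 : algebraMap K (𝔭.adicCompletion K) k =
      z + -(z - algebraMap K (𝔭.adicCompletion K) k) := by ring
    rw [h1, map_one, norm_one]
    refine (𝔭.norm_add_le_max _ _).trans (max_le hz ?_)
    rw [norm_neg]
    exact hk.le.trans (min_le_right _ _)
  rw [norm_algebraMap_le_iff, map_one] at hk1
  obtain ⟨r, hr⟩ := 𝔭.exists_valuation_sub_lt_of_integer hk1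
    (Units.mk0 _ ((Valuation.ne_zero_iff (𝔭.valuation K)).2 hy))
  refine ⟨r, ?_⟩
  have h2 : z - algebraMap K (𝔭.adicCompletion K) r =
      (z - algebraMap K (𝔭.adicCompletion K) k) +
        -(algebraMap K (𝔭.adicCompletion K) (algebraMap (𝓞 K) K r - k)) := by
    rw [map_sub]; ring
  rw [h2]
  refine (𝔭.norm_add_le_max _ _).trans (max_le (hk.le.trans (min_le_left _ _)) ?_)
  rw [norm_neg, norm_algebraMap_le_iff]
  exact hr.le

instance (𝔭 : HeightOneSpectrum (𝓞 K)) : ProperSpace (𝔭.adicCompletion K) := by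
  rw [Valued.integer.properSpace_iff_completeSpace_and_isDiscreteValuationRing_integer_and_finite_residueField]
  refine ⟨inferInstance, inferInstanceAs (IsDiscreteValuationRing (𝔭.adicCompletionIntegers K)), ?_⟩
  have hfin : Finite (𝓞 K ⧸ 𝔭.asIdeal) := 𝔭.asIdeal.finiteQuotientOfFreeOfNeBot 𝔭.ne_bot
  have hlt : ∀ r ∈ 𝔭.asIdeal, ‖algebraMap K (𝔭.adicCompletion K) (r : K)‖ < 1 := fun r hr =>
    (FinitePlace.norm_lt_one_iff_mem K 𝔭 r).2 hr
  have hint : ∀ r : 𝓞 K, algebraMap K (𝔭.adicCompletion K) (r : K) ∈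
      Valued.integer (𝔭.adicCompletion K) := fun r =>
    Valued.toNormedField.norm_le_one_iff.1 (FinitePlace.norm_le_one K 𝔭 r)
  -- The residue field is finite because global integers meet every residue class. An arbitrary
  -- choice of representatives is enough; no ring homomorphism is needed.
  refine Finite.of_surjective (fun q : 𝓞 K ⧸ 𝔭.asIdeal =>
    IsLocalRing.residue (Valued.integer (𝔭.adicCompletion K)) ⟨_, hint q.out⟩) ?_
  intro y
  obtain ⟨z, rfl⟩ := IsLocalRing.residue_surjective y
  obtain ⟨π, hπ, hπ0⟩ := 𝔭.asIdeal.ne_bot_iff.1 𝔭.ne_bot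
  have hz : ‖(z : 𝔭.adicCompletion K)‖ ≤ 1 := Valued.toNormedField.norm_le_one_iff.2 z.2
  obtain ⟨r, hr⟩ := 𝔭.exists_norm_sub_algebraMap_le hz
    (y := (π : K)) (by simpa using hπ0)
  refine ⟨Ideal.Quotient.mk _ r, ?_⟩
  refine Ideal.Quotient.eq.2 ?_
  rw [IsLocalRing.mem_maximalIdeal, mem_nonunits_iff,
    Valuation.Integer.not_isUnit_iff_valuation_lt_one, ← Valued.toNormedField.norm_lt_one_iff]
  set s : 𝓞 K := (Ideal.Quotient.mk 𝔭.asIdeal r).out with hs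
  have hsr : s - r ∈ 𝔭.asIdeal := by
    rw [← Ideal.Quotient.eq, hs]
    exact Quotient.out_eq _
  have heq : algebraMap K (𝔭.adicCompletion K) (s : K) - (z : 𝔭.adicCompletion K) =
      algebraMap K (𝔭.adicCompletion K) ((s - r : 𝓞 K) : K) +
        -((z : 𝔭.adicCompletion K) - algebraMap K (𝔭.adicCompletion K) (r : K)) := by
    have h1 : ((s - r : 𝓞 K) : K) = (s : K) - (r : K) := map_sub (algebraMap (𝓞 K) K) s r
    rw [h1, map_sub]; ring
  change ‖algebraMap K (𝔭.adicCompletion K) (s : K) - (z : 𝔭.adicCompletion K)‖ < 1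
  rw [heq]
  refine (𝔭.norm_add_le_max _ _).trans_lt (max_lt (hlt _ hsr) ?_)
  rw [norm_neg]
  exact hr.trans_lt (hlt π hπ)

end Completions

namespace PisotSubstitution

variable {A : Type*} [Fintype A] [DecidableEq A] (σ : PisotSubstitution A)

/-! ### The representation space as a normed ring -/

theorem α_ne_zero : σ.α ≠ 0 := by
  intro h
  have h1 := σ.root_pisot.one_lt
  rw [← σ.coe_α, h] at h1
  norm_num at h1

theorem αInt_ne_zero : σ.αInt ≠ 0 := fun h => σ.α_ne_zero (congrArg (fun x : 𝓞 σ.K => (x : σ.K)) h)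

instance : Fintype σ.InfPrimes := Fintype.ofFinite _

instance : Finite σ.FinPrimes :=
  (Ideal.finite_factors (by simpa using σ.αInt_ne_zero :
    Ideal.span {σ.αInt} ≠ 0)).to_subtype

instance : Fintype σ.FinPrimes := Fintype.ofFinite _

instance : ProperSpace σ.RepSpace := inferInstance

instance : SecondCountableTopology σ.RepSpace := inferInstance

instance : PolishSpace σ.RepSpace := inferInstance

theorem norm_Φ'_le_iff {x : σ.K} {r : ℝ} (hr : 0 ≤ r) : ‖σ.Φ' x‖ ≤ r ↔
    (∀ w : σ.InfPrimes, w.1 x ≤ r) ∧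
      ∀ 𝔭 : σ.FinPrimes, ‖algebraMap σ.K (𝔭.1.adicCompletion σ.K) x‖ ≤ r := by
  rw [Prod.norm_def, max_le_iff, pi_norm_le_iff_of_nonneg hr, pi_norm_le_iff_of_nonneg hr]
  refine and_congr (forall_congr' fun w => ?_) Iff.rfl
  have h := InfinitePlace.Completion.norm_coe w.1 ((WithAbs.equiv w.1.1).symm x)
  exact ⟨fun h' => h.symm.trans_le h', fun h' => h.trans_le h'⟩

theorem eq_p₁_of_embedding_α {w : InfinitePlace σ.K} (h : w.embedding σ.α = (σ.root : ℂ)) :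
    w = σ.p₁ := by
  have h1 : w.embedding = (algebraMap ℝ ℂ).comp (algebraMap σ.K ℝ) := by
    have h2 : w.embedding.toRatAlgHom =
        ((algebraMap ℝ ℂ).comp (algebraMap σ.K ℝ)).toRatAlgHom := by
      refine IntermediateField.algHom_ext_of_eq_adjoin _ rfl ?_
      rintro x rfl
      exact h
    ext x
    exact DFunLike.congr_fun h2 x
  rw [← InfinitePlace.mk_embedding w, h1]
  rfl

/-- The image of `α` at another place is a conjugate different from `α`, since an embedding of
`ℚ(α)` is determined by the image of `α`. -/
theorem infinitePlace_α_lt_one (w : σ.InfPrimes) : w.1 σ.α < 1 := by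
  rw [← InfinitePlace.norm_embedding_eq]
  refine σ.root_pisot.conjugates _ ?_ fun h => w.2 (σ.eq_p₁_of_embedding_α h)
  have h1 : minpoly ℚ σ.root = minpoly ℚ σ.α := (IntermediateField.minpoly_gen ℚ σ.root).symm
  have h2 := congrArg w.1.embedding (minpoly.aeval ℚ σ.α)
  rw [map_zero] at h2
  rw [h1, ← h2]
  exact Polynomial.aeval_algHom_apply w.1.embedding.toRatAlgHom σ.α _

theorem norm_α_lt_one (𝔭 : σ.FinPrimes) :
    ‖algebraMap σ.K (𝔭.1.adicCompletion σ.K) σ.α‖ < 1 :=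
  (FinitePlace.norm_lt_one_iff_mem σ.K 𝔭.1 σ.αInt).2
    (Ideal.dvd_span_singleton.1 𝔭.2)

theorem norm_Φ'_α_lt_one : ‖σ.Φ' σ.α‖ < 1 := by
  rw [Prod.norm_def, max_lt_iff, pi_norm_lt_iff one_pos, pi_norm_lt_iff one_pos]
  refine ⟨fun w => ?_, σ.norm_α_lt_one⟩
  exact (InfinitePlace.Completion.norm_coe w.1 ((WithAbs.equiv w.1.1).symm σ.α)).trans_lt
    (σ.infinitePlace_α_lt_one w)

/-! ### The module `V · ℤ[α⁻¹]` -/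

variable {v : A → σ.K}

theorem δ_flatMap (hv : σ.IsPositiveLeftEigenvector v) (a : A) :
    σ.δ v (σ.toFun a) = σ.α * v a := by
  have h := congrFun hv.1 a
  rw [Pi.smul_apply, smul_eq_mul] at h
  rw [← h]
  simp [δ, Matrix.vecMul, dotProduct, WordSubstitution.incidence, mul_comm]

variable (v) in
/-- The module `V · ℤ[α⁻¹]`. -/
def L : Submodule ℤ σ.K := σ.V v * Subalgebra.toSubmodule (Algebra.adjoin ℤ {σ.α⁻¹})

theorem V_le_L : σ.V v ≤ σ.L v := by
  intro x hx
  have := Submodule.mul_mem_mul hx ((Subalgebra.mem_toSubmodule _).2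
    (one_mem (Algebra.adjoin ℤ {σ.α⁻¹})))
  rwa [mul_one] at this

theorem v_mem_V (a : A) : v a ∈ σ.V v := Submodule.subset_span ⟨a, rfl⟩

theorem δ_mem_V (p : List A) : σ.δ v p ∈ σ.V v := by
  refine Submodule.sum_mem _ fun a _ => ?_
  rw [← nsmul_eq_mul]
  exact Submodule.smul_of_tower_mem _ _ (σ.v_mem_V a)

theorem α_mul_mem_V (hv : σ.IsPositiveLeftEigenvector v) {x : σ.K} (hx : x ∈ σ.V v) :
    σ.α * x ∈ σ.V v := by
  induction hx using Submodule.span_induction with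
  | mem x hx =>
    obtain ⟨a, rfl⟩ := hx
    rw [← σ.δ_flatMap hv]
    exact σ.δ_mem_V _
  | zero => simp
  | add x y _ _ hx hy => rw [mul_add]; exact add_mem hx hy
  | smul n x _ hx => rw [mul_smul_comm]; exact Submodule.smul_mem _ _ hx

theorem α_pow_mul_mem_V (hv : σ.IsPositiveLeftEigenvector v) (n : ℕ) {x : σ.K} (hx : x ∈ σ.V v) :
    σ.α ^ n * x ∈ σ.V v := by
  induction n with
  | zero => simpa
  | succ n ih => rw [pow_succ', mul_assoc]; exact σ.α_mul_mem_V hv ih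

/-- `V` is stable under `α`, so `V · ℤ[α⁻¹]` is the increasing union of the modules `α⁻ⁿ V`. -/
theorem mem_L_iff (hv : σ.IsPositiveLeftEigenvector v) {x : σ.K} :
    x ∈ σ.L v ↔ ∃ n : ℕ, σ.α ^ n * x ∈ σ.V v := by
  constructor
  · intro hx
    induction hx using Submodule.mul_induction_on' with
    | mem_mul_mem y hy z hz =>
      have hz' : z ∈ Algebra.adjoin ℤ {σ.α⁻¹} := hz
      clear hz
      rw [Algebra.adjoin_singleton_eq_range_aeval] at hz'
      obtain ⟨p, rfl⟩ := hz'
      refine ⟨p.natDegree, ?_⟩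
      change σ.α ^ p.natDegree * (y * Polynomial.aeval σ.α⁻¹ p) ∈ σ.V v
      rw [Polynomial.aeval_eq_sum_range, Finset.mul_sum, Finset.mul_sum]
      refine Submodule.sum_mem _ fun i hi => ?_
      have hi' : i ≤ p.natDegree := Nat.lt_succ_iff.1 (Finset.mem_range.1 hi)
      have h1 : σ.α ^ p.natDegree * (y * p.coeff i • σ.α⁻¹ ^ i) =
          p.coeff i • (σ.α ^ (p.natDegree - i) * y) := by
        rw [pow_sub₀ _ σ.α_ne_zero hi', inv_pow, mul_smul_comm, mul_smul_comm]
        congr 1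
        ring
      rw [h1]
      exact Submodule.smul_mem _ _ (σ.α_pow_mul_mem_V hv _ hy)
    | add x _ y _ hx hy =>
      obtain ⟨m, hm⟩ := hx
      obtain ⟨n, hn⟩ := hy
      refine ⟨m + n, ?_⟩
      rw [mul_add]
      refine add_mem ?_ ?_
      · rw [add_comm, pow_add, mul_assoc]
        exact σ.α_pow_mul_mem_V hv _ hm
      · rw [pow_add, mul_assoc]
        exact σ.α_pow_mul_mem_V hv _ hn
  · rintro ⟨n, hn⟩
    have h1 : x = (σ.α ^ n * x) * σ.α⁻¹ ^ n := by
      rw [mul_right_comm, ← mul_pow, mul_inv_cancel₀ σ.α_ne_zero, one_pow, one_mul]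
    have h2 : σ.α⁻¹ ^ n ∈ Algebra.adjoin ℤ {σ.α⁻¹} :=
      pow_mem (Algebra.subset_adjoin (Set.mem_singleton _)) n
    rw [h1]
    exact Submodule.mul_mem_mul hn ((Subalgebra.mem_toSubmodule _).2 h2)

theorem α_mul_mem_L_iff (hv : σ.IsPositiveLeftEigenvector v) {x : σ.K} :
    σ.α * x ∈ σ.L v ↔ x ∈ σ.L v := by
  rw [σ.mem_L_iff hv, σ.mem_L_iff hv]
  constructor
  · rintro ⟨n, hn⟩
    exact ⟨n + 1, by rwa [pow_succ, mul_assoc]⟩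
  · rintro ⟨n, hn⟩
    refine ⟨n, ?_⟩
    rw [mul_left_comm]
    exact σ.α_mul_mem_V hv hn

theorem p₁_apply (x : σ.K) : σ.p₁ x = |(x : ℝ)| := by
  rw [p₁, InfinitePlace.apply]
  simp

variable (v) in
theorem exists_integral_mul : ∃ d : 𝓞 σ.K, d ≠ 0 ∧
    ∀ x ∈ σ.V v, ∃ r : 𝓞 σ.K, (r : σ.K) = (d : σ.K) * x := by
  obtain ⟨d, hd⟩ := IsLocalization.exist_integer_multiples_of_finite
    (nonZeroDivisors (𝓞 σ.K)) v
  refine ⟨d, nonZeroDivisors.coe_ne_zero d, fun x hx => ?_⟩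
  induction hx using Submodule.span_induction with
  | mem x hx =>
    obtain ⟨a, rfl⟩ := hx
    obtain ⟨r, hr⟩ := hd a
    exact ⟨r, hr.trans (Algebra.smul_def _ _)⟩
  | zero => exact ⟨0, by simp⟩
  | add x y _ _ hx hy =>
    obtain ⟨r, hr⟩ := hx
    obtain ⟨s, hs⟩ := hy
    exact ⟨r + s, by rw [mul_add, ← hr, ← hs]; exact map_add (algebraMap (𝓞 σ.K) σ.K) r s⟩
  | smul n x _ hx =>
    obtain ⟨r, hr⟩ := hx
    exact ⟨n • r, by rw [mul_smul_comm, ← hr]; exact map_zsmul (algebraMap (𝓞 σ.K) σ.K) n r⟩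

/-- Discreteness of `L`. One factor `y = d α^N` clears all denominators: `d` those of `V`, and `α^N`
those at primes dividing `(α)`, which `B` bounds. What remains are algebraic integers with bounded
conjugates. -/
theorem finite_setOf_mem_L (hv : σ.IsPositiveLeftEigenvector v) (c : ℝ) {B : ℝ} (hB : 0 ≤ B) :
    {x : σ.K | x ∈ σ.L v ∧ |(x : ℝ)| ≤ c ∧ ‖σ.Φ' x‖ ≤ B}.Finite := by
  obtain ⟨d, hd0, hd⟩ := σ.exists_integral_mul v
  have hd0' : (d : σ.K) ≠ 0 := by simpa using hd0
  obtain ⟨N, hN⟩ : ∃ N : ℕ, ‖σ.Φ' σ.α‖ ^ N * B ≤ 1 := by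
    have h := (tendsto_pow_atTop_nhds_zero_of_lt_one (norm_nonneg _)
      σ.norm_Φ'_α_lt_one).mul_const B
    rw [zero_mul] at h
    exact (h.eventually_le_const one_pos).exists
  set y : σ.K := (d : σ.K) * σ.α ^ N with hy
  have hy0 : y ≠ 0 := mul_ne_zero hd0' (pow_ne_zero _ σ.α_ne_zero)
  refine Set.Finite.of_finite_image (f := fun x => y * x) ?_ (mul_right_injective₀ hy0).injOn
  refine (Embeddings.finite_of_norm_le σ.K ℂ
    ((∑ w : InfinitePlace σ.K, w y) * max c B)).subset ?_
  rintro _ ⟨x, ⟨hxL, hxc, hxB⟩, rfl⟩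
  rw [σ.norm_Φ'_le_iff hB] at hxB
  have hα := (σ.norm_Φ'_le_iff (x := σ.α) (norm_nonneg _)).1 le_rfl
  constructor
  · suffices hval : ∀ 𝔭 : HeightOneSpectrum (𝓞 σ.K), 𝔭.valuation σ.K (y * x) ≤ 1 by
      obtain ⟨r, hr⟩ := HeightOneSpectrum.mem_integers_of_valuation_le_one σ.K (y * x) hval
      exact (congrArg (IsIntegral ℤ) hr).mp r.2
    intro 𝔭
    by_cases h𝔭 : 𝔭.asIdeal ∣ Ideal.span {σ.αInt}
    · rw [← map_one (𝔭.valuation σ.K), ← 𝔭.norm_algebraMap_le_iff, map_one, norm_one, hy, map_mul,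
        map_mul, map_pow, norm_mul, norm_mul, norm_pow]
      have h1 : ‖algebraMap σ.K (𝔭.adicCompletion σ.K) (d : σ.K)‖ ≤ 1 :=
        FinitePlace.norm_le_one σ.K 𝔭 d
      have h2 := hα.2 ⟨𝔭, h𝔭⟩
      have h3 := hxB.2 ⟨𝔭, h𝔭⟩
      calc _ ≤ 1 * ‖σ.Φ' σ.α‖ ^ N * B := by gcongr
        _ ≤ 1 := by rwa [one_mul]
    -- Away from `(α)` the element `α` is a local unit, so its powers do not affect integrality.
    · have hα1 : 𝔭.valuation σ.K σ.α = 1 :=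
        (HeightOneSpectrum.valuation_eq_one_iff_notMem (v := 𝔭) (r := σ.αInt)).2
          fun h => h𝔭 (Ideal.dvd_span_singleton.2 h)
      obtain ⟨n, hn⟩ := (σ.mem_L_iff hv).1 hxL
      obtain ⟨r, hr⟩ := hd _ hn
      have h1 := 𝔭.valuation_le_one (K := σ.K) r
      change 𝔭.valuation σ.K (r : σ.K) ≤ 1 at h1
      rw [hr, map_mul, map_mul, map_pow, hα1, one_pow, one_mul] at h1
      rwa [hy, map_mul, map_mul, map_pow, hα1, one_pow, mul_one]
  · intro φ
    rw [← InfinitePlace.apply φ, map_mul]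
    refine mul_le_mul ?_ ?_ (apply_nonneg _ _) (Finset.sum_nonneg fun w _ => apply_nonneg _ _)
    · exact Finset.single_le_sum (f := fun w : InfinitePlace σ.K => w y)
        (fun w _ => apply_nonneg _ _) (Finset.mem_univ _)
    · by_cases h : InfinitePlace.mk φ = σ.p₁
      · rw [h, p₁_apply]
        exact hxc.trans (le_max_left _ _)
      · exact (hxB.1 ⟨_, h⟩).trans (le_max_right _ _)

/-! ### Cocompactness -/

/-- Scaling by `α^N` makes `z` integral. Global integers approximate it modulo `α^N` at each prime,
the Chinese remainder theorem glues them, and scaling back leaves an error at most `1`. -/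
theorem exists_sub_inv_pow_mul_norm_le (z : ∀ 𝔭 : σ.FinPrimes, 𝔭.1.adicCompletion σ.K) :
    ∃ (N : ℕ) (r : 𝓞 σ.K), ∀ 𝔭 : σ.FinPrimes,
      ‖z 𝔭 - algebraMap σ.K (𝔭.1.adicCompletion σ.K) (σ.α⁻¹ ^ N * r)‖ ≤ 1 := by
  obtain ⟨N, hN⟩ : ∃ N : ℕ, ‖σ.Φ' σ.α‖ ^ N * ‖z‖ ≤ 1 := by
    have h := (tendsto_pow_atTop_nhds_zero_of_lt_one (norm_nonneg _)
      σ.norm_Φ'_α_lt_one).mul_const ‖z‖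
    rw [zero_mul] at h
    exact (h.eventually_le_const one_pos).exists
  have hα := ((σ.norm_Φ'_le_iff (x := σ.α) (norm_nonneg _)).1 le_rfl).2
  have hαN : σ.α ^ N ≠ 0 := pow_ne_zero _ σ.α_ne_zero
  have h1 : ∀ 𝔭 : σ.FinPrimes, ∃ r : 𝓞 σ.K,
      ‖algebraMap σ.K (𝔭.1.adicCompletion σ.K) (σ.α ^ N) * z 𝔭 -
        algebraMap σ.K (𝔭.1.adicCompletion σ.K) r‖ ≤
      ‖algebraMap σ.K (𝔭.1.adicCompletion σ.K) (σ.α ^ N)‖ := by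
    intro 𝔭
    refine 𝔭.1.exists_norm_sub_algebraMap_le ?_ hαN
    rw [map_pow, norm_mul, norm_pow]
    refine le_trans ?_ hN
    have := hα 𝔭
    have h2 := norm_le_pi_norm z 𝔭
    gcongr
  choose r hr using h1
  have h2 : ∀ 𝔭 : σ.FinPrimes, ∃ e : ℕ, ∀ s ∈ 𝔭.1.asIdeal ^ e,
      ‖algebraMap σ.K (𝔭.1.adicCompletion σ.K) (s : σ.K)‖ ≤
        ‖algebraMap σ.K (𝔭.1.adicCompletion σ.K) (σ.α ^ N)‖ := by
    intro 𝔭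
    have h0 : σ.αInt ^ N ≠ 0 := pow_ne_zero _ σ.αInt_ne_zero
    have h1 := 𝔭.1.intValuation_if_neg h0
    refine ⟨(Associates.mk 𝔭.1.asIdeal).count
      (Associates.mk (Ideal.span {σ.αInt ^ N})).factors, fun s hs => ?_⟩
    rw [HeightOneSpectrum.norm_algebraMap_le_iff]
    change 𝔭.1.valuation σ.K (algebraMap (𝓞 σ.K) σ.K s) ≤
      𝔭.1.valuation σ.K (algebraMap (𝓞 σ.K) σ.K (σ.αInt ^ N))
    rw [HeightOneSpectrum.valuation_of_algebraMap, HeightOneSpectrum.valuation_of_algebraMap, h1]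
    exact (𝔭.1.intValuation_le_pow_iff_mem _ _).2 hs
  choose e he using h2
  obtain ⟨s, hs⟩ := exists_forall_sub_mem_ideal (s := Finset.univ)
    (fun 𝔭 : σ.FinPrimes => 𝔭.1.asIdeal) e (fun 𝔭 _ => 𝔭.1.prime)
    (fun 𝔭 _ 𝔮 _ h h' => h (Subtype.ext (HeightOneSpectrum.ext h'))) (fun 𝔭 => r 𝔭.1)
  refine ⟨N, s, fun 𝔭 => ?_⟩
  have hpos : 0 < ‖algebraMap σ.K (𝔭.1.adicCompletion σ.K) (σ.α ^ N)‖ :=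
    norm_pos_iff.2 ((map_ne_zero _).2 hαN)
  refine le_of_mul_le_mul_left ?_ hpos
  rw [← norm_mul, mul_one, mul_sub, ← map_mul, ← mul_assoc, ← mul_pow,
    mul_inv_cancel₀ σ.α_ne_zero, one_pow, one_mul]
  have h3 : algebraMap σ.K (𝔭.1.adicCompletion σ.K) (σ.α ^ N) * z 𝔭 -
        algebraMap σ.K (𝔭.1.adicCompletion σ.K) s =
      (algebraMap σ.K (𝔭.1.adicCompletion σ.K) (σ.α ^ N) * z 𝔭 -
        algebraMap σ.K (𝔭.1.adicCompletion σ.K) (r 𝔭)) +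
      -(algebraMap σ.K (𝔭.1.adicCompletion σ.K) ((s - r 𝔭 : 𝓞 σ.K) : σ.K)) := by
    have h4 : ((s - r 𝔭 : 𝓞 σ.K) : σ.K) = (s : σ.K) - (r 𝔭 : σ.K) :=
      map_sub (algebraMap (𝓞 σ.K) σ.K) s (r 𝔭)
    rw [h4, map_sub]; ring
  rw [h3]
  refine (𝔭.1.norm_add_le_max _ _).trans (max_le (hr 𝔭) ?_)
  rw [norm_neg]
  exact he 𝔭 _ (hs 𝔭 (Finset.mem_univ _))

/-- Round the coordinates in an integral basis down; the fractional parts that remain are bounded.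
-/
theorem exists_forall_infinitePlace_sub_le (K : Type*) [Field K] [NumberField K] : ∃ C : ℝ, 0 ≤ C ∧
    ∀ k : K, ∃ o : 𝓞 K, ∀ w : InfinitePlace K, w (k - o) ≤ C := by
  refine ⟨∑ w : InfinitePlace K, ∑ i, w (integralBasis K i),
    Finset.sum_nonneg fun w _ => Finset.sum_nonneg fun i _ => apply_nonneg _ _, fun k => ?_⟩
  refine ⟨∑ i, ⌊(integralBasis K).repr k i⌋ • RingOfIntegers.basis K i, fun w => ?_⟩
  have h1 : k - ((∑ i, ⌊(integralBasis K).repr k i⌋ • RingOfIntegers.basis K i : 𝓞 K) : K) =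
      ∑ i, Int.fract ((integralBasis K).repr k i) • integralBasis K i := by
    have h2 : ((∑ i, ⌊(integralBasis K).repr k i⌋ • RingOfIntegers.basis K i : 𝓞 K) : K) =
        ∑ i, ⌊(integralBasis K).repr k i⌋ • integralBasis K i := by
      change algebraMap (𝓞 K) K _ = _
      simp only [map_sum, map_zsmul, integralBasis_apply]
    have h3 := (integralBasis K).sum_repr k
    rw [h2]
    nth_rewrite 1 [← h3]
    rw [← Finset.sum_sub_distrib]
    refine Finset.sum_congr rfl fun i _ => ?_
    rw [← Int.cast_smul_eq_zsmul ℚ, ← sub_smul, Int.fract]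
  rw [h1]
  refine le_trans ?_ (Finset.single_le_sum (f := fun w : InfinitePlace K =>
    ∑ i, w (integralBasis K i)) (fun w _ => Finset.sum_nonneg fun i _ => apply_nonneg _ _)
    (Finset.mem_univ w))
  rw [← InfinitePlace.norm_embedding_eq, map_sum]
  refine (norm_sum_le _ _).trans (Finset.sum_le_sum fun i _ => ?_)
  rw [Algebra.smul_def, map_mul, norm_mul, InfinitePlace.norm_embedding_eq w (integralBasis K i)]
  refine mul_le_of_le_one_left (apply_nonneg _ _) ?_
  simp only [eq_ratCast, map_ratCast, Complex.norm_ratCast]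
  rw [abs_of_nonneg (by exact_mod_cast Int.fract_nonneg _)]
  exact_mod_cast (Int.fract_lt_one _).le

/-- As `K = ℚ[α]`, a subspace stable under `α` is an ideal of a field. -/
theorem eq_top_of_α_mul_mem {W : Submodule ℚ σ.K} {w : σ.K} (hw : w ∈ W) (hw0 : w ≠ 0)
    (hW : ∀ x ∈ W, σ.α * x ∈ W) : W = ⊤ := by
  have h1 : Algebra.adjoin ℚ {σ.α} = ⊤ := by
    have := (IntermediateField.adjoin.powerBasis
      (σ.root_pisot.isIntegral.tower_top (A := ℚ))).adjoin_gen_eq_top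
    rwa [IntermediateField.adjoin.powerBasis_gen] at this
  have h2 : ∀ y : σ.K, ∀ x ∈ W, y * x ∈ W := by
    intro y
    have hy : y ∈ Algebra.adjoin ℚ {σ.α} := h1 ▸ Algebra.mem_top
    induction hy using Algebra.adjoin_induction with
    | mem y hy => rw [hy]; exact hW
    | algebraMap q => intro x hx; rw [← Algebra.smul_def]; exact W.smul_mem q hx
    | add y z _ _ hy hz => intro x hx; rw [add_mul]; exact W.add_mem (hy x hx) (hz x hx)
    | mul y z _ _ hy hz => intro x hx; rw [mul_assoc]; exact hy _ (hz x hx)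
  refine eq_top_iff.2 fun x _ => ?_
  have := h2 (x * w⁻¹) w hw
  rwa [inv_mul_cancel_right₀ hw0] at this

theorem nonempty_alphabet {A : Type*} [Fintype A] [DecidableEq A] (σ : PisotSubstitution A) :
    Nonempty A := ⟨σ.growth.choose⟩

theorem span_rat_range_eq_top (hv : σ.IsPositiveLeftEigenvector v) :
    Submodule.span ℚ (Set.range v) = ⊤ := by
  obtain ⟨a⟩ := σ.nonempty_alphabet
  refine σ.eq_top_of_α_mul_mem (Submodule.subset_span ⟨a, rfl⟩) ?_ ?_
  · intro h
    have := hv.2 a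
    rw [h] at this
    norm_num at this
  · intro x hx
    induction hx using Submodule.span_induction with
    | mem x hx =>
      obtain ⟨b, rfl⟩ := hx
      exact (Submodule.span_subset_span ℤ ℚ _) (σ.α_mul_mem_V hv (σ.v_mem_V b))
    | zero => simp
    | add x y _ _ hx hy => rw [mul_add]; exact add_mem hx hy
    | smul n x _ hx => rw [mul_smul_comm]; exact Submodule.smul_mem _ _ hx

theorem exists_nsmul_mem_V (hv : σ.IsPositiveLeftEigenvector v) (x : σ.K) :
    ∃ m : ℕ, m ≠ 0 ∧ (m : σ.K) * x ∈ σ.V v := by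
  have hx : x ∈ Submodule.span ℚ (Set.range v) := σ.span_rat_range_eq_top hv ▸ Submodule.mem_top
  have hnat : ∀ (m : ℕ) {y : σ.K}, y ∈ σ.V v → (m : σ.K) * y ∈ σ.V v := by
    intro m y hy
    rw [← nsmul_eq_mul]
    exact Submodule.smul_of_tower_mem _ _ hy
  induction hx using Submodule.span_induction with
  | mem x hx => exact ⟨1, one_ne_zero, by rw [Nat.cast_one, one_mul]; exact Submodule.subset_span hx⟩
  | zero => exact ⟨1, one_ne_zero, by simp⟩
  | add x y _ _ hx hy =>
    obtain ⟨m, hm, hx⟩ := hx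
    obtain ⟨n, hn, hy⟩ := hy
    refine ⟨m * n, mul_ne_zero hm hn, ?_⟩
    rw [mul_add]
    refine add_mem ?_ ?_
    · rw [mul_comm m, Nat.cast_mul, mul_assoc]; exact hnat n hx
    · rw [Nat.cast_mul, mul_assoc]; exact hnat m hy
  | smul q x _ hx =>
    obtain ⟨m, hm, hx⟩ := hx
    refine ⟨q.den * m, mul_ne_zero q.den_nz hm, ?_⟩
    have : ((q.den * m : ℕ) : σ.K) * (q • x) = q.num • ((m : σ.K) * x) := by
      rw [Algebra.smul_def, zsmul_eq_mul, Nat.cast_mul]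
      have h : ((q.den : ℚ) : σ.K) * (q : σ.K) = ((q.num : ℚ) : σ.K) := by
        rw [← Rat.cast_mul, Rat.den_mul_eq_num]
      push_cast at h
      simp only [eq_ratCast]
      linear_combination (m : σ.K) * x * h
    rw [this]
    exact Submodule.smul_mem _ _ hx

theorem exists_nat_mul_integer_mem_V (hv : σ.IsPositiveLeftEigenvector v) :
    ∃ m : ℕ, m ≠ 0 ∧ ∀ r : 𝓞 σ.K, (m : σ.K) * r ∈ σ.V v := by
  choose m hm hmV using fun i => σ.exists_nsmul_mem_V hv (integralBasis σ.K i)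
  refine ⟨∏ i, m i, Finset.prod_ne_zero_iff.2 fun i _ => hm i, fun r => ?_⟩
  have h1 : (r : σ.K) = ∑ i, (RingOfIntegers.basis σ.K).repr r i • integralBasis σ.K i := by
    conv_lhs => rw [← (RingOfIntegers.basis σ.K).sum_repr r]
    change algebraMap (𝓞 σ.K) σ.K _ = _
    simp only [map_sum, map_zsmul, integralBasis_apply]
  rw [h1, Finset.mul_sum]
  refine Submodule.sum_mem _ fun i _ => ?_
  rw [mul_smul_comm]
  refine Submodule.smul_mem _ _ ?_
  rw [← Finset.mul_prod_erase _ _ (Finset.mem_univ i), mul_comm (m i), Nat.cast_mul, mul_assoc,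
    ← nsmul_eq_mul]
  exact Submodule.smul_of_tower_mem _ _ (hmV i)

/-- The image of `V · ℤ[α⁻¹]` in `ℝ × RepSpace` is relatively dense. -/
theorem exists_mem_L_near (hv : σ.IsPositiveLeftEigenvector v) :
    ∃ c : ℝ, 0 ≤ c ∧ ∀ (t : ℝ) (z : σ.RepSpace),
      ∃ x ∈ σ.L v, |t - (x : ℝ)| ≤ c ∧ ‖z - σ.Φ' x‖ ≤ c := by
  obtain ⟨C, hC0, hC⟩ := exists_forall_infinitePlace_sub_le σ.K
  obtain ⟨m, hm0, hm⟩ := σ.exists_nat_mul_integer_mem_V hv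
  have hm0' : (m : σ.K) ≠ 0 := by exact_mod_cast hm0
  set M : ℝ := ∑ w : InfinitePlace σ.K, w (m : σ.K) with hM
  have hMw : ∀ w : InfinitePlace σ.K, w (m : σ.K) ≤ M := fun w =>
    Finset.single_le_sum (f := fun w : InfinitePlace σ.K => w (m : σ.K))
      (fun w _ => apply_nonneg _ _) (Finset.mem_univ w)
  have hM0 : 0 ≤ M := Finset.sum_nonneg fun w _ => apply_nonneg _ _
  -- At the infinite places `M` bounds `m`, the `1` comes from weak approximation and `C` from
  -- rounding to an integer. The `2` covers both the replacement of `t` by a rational and the error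
  -- at the finite places.
  refine ⟨M * (1 + C) + 2, by positivity, fun t z => ?_⟩
  obtain ⟨τ, hτ1, hτ2⟩ := exists_rat_btwn (lt_add_one t)
  obtain ⟨N, r, hr⟩ := σ.exists_sub_inv_pow_mul_norm_le
    (fun 𝔭 => z.2 𝔭 * algebraMap σ.K (𝔭.1.adicCompletion σ.K) (m : σ.K)⁻¹)
  set y : σ.K := σ.α⁻¹ ^ N * r with hy
  classical
  let ξ : InfiniteAdeleRing σ.K := fun w =>
    if h : w = σ.p₁ then algebraMap σ.K w.Completion ((τ : σ.K) * (m : σ.K)⁻¹ - y)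
    else z.1 ⟨w, h⟩ * algebraMap σ.K w.Completion (m : σ.K)⁻¹ - algebraMap σ.K w.Completion y
  obtain ⟨k, hk⟩ : ∃ k : σ.K, ∀ w : InfinitePlace σ.K,
      ‖ξ w - algebraMap σ.K w.Completion k‖ ≤ 1 := by
    have hopen : IsOpen {η : InfiniteAdeleRing σ.K | ∀ w, ‖ξ w - η w‖ < 1} := by
      simp only [Set.ofPred_forall]
      refine isOpen_iInter_of_finite fun w => ?_
      have hw : Continuous fun η : InfiniteAdeleRing σ.K => η w := continuous_apply w
      exact isOpen_lt ((continuous_const.sub hw).norm) continuous_const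
    obtain ⟨k, hk⟩ := (InfiniteAdeleRing.denseRange_algebraMap σ.K).exists_mem_open hopen
      ⟨ξ, fun w => by simp⟩
    exact ⟨k, fun w => (hk w).le⟩
  obtain ⟨o, ho⟩ := hC k
  have hnorm : ∀ (w : InfinitePlace σ.K) (x : σ.K), ‖algebraMap σ.K w.Completion x‖ = w x :=
    fun w x => InfinitePlace.Completion.norm_coe w ((WithAbs.equiv w.1).symm x)
  have hmain : ∀ w : InfinitePlace σ.K,
      ‖algebraMap σ.K w.Completion m * (ξ w - algebraMap σ.K w.Completion (o : σ.K))‖ ≤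
        M * (1 + C) := by
    intro w
    rw [norm_mul, hnorm]
    refine mul_le_mul (hMw w) ?_ (norm_nonneg _) hM0
    have h1 : ξ w - algebraMap σ.K w.Completion (o : σ.K) =
        (ξ w - algebraMap σ.K w.Completion k) + algebraMap σ.K w.Completion (k - o) := by
      rw [map_sub]; ring
    rw [h1]
    refine (norm_add_le _ _).trans (add_le_add (hk w) ?_)
    rw [hnorm]
    exact ho w
  -- `y` serves the finite places and `o` corrects the infinite ones; being integral, `o` costs at
  -- most `1` at each finite prime. The factor `m` moves `y + o` into `L`.
  refine ⟨(m : σ.K) * (y + o), ?_, ?_, ?_⟩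
  · rw [mul_add]
    refine add_mem ?_ (σ.V_le_L (hm o))
    rw [σ.mem_L_iff hv]
    refine ⟨N, ?_⟩
    have : σ.α ^ N * ((m : σ.K) * y) = (m : σ.K) * r := by
      rw [hy, mul_left_comm, ← mul_assoc (σ.α ^ N), ← mul_pow, mul_inv_cancel₀ σ.α_ne_zero,
        one_pow, one_mul]
    rw [this]
    exact hm r
  · have h1 := hmain σ.p₁
    have h2 : algebraMap σ.K σ.p₁.Completion m * (ξ σ.p₁ -
        algebraMap σ.K σ.p₁.Completion (o : σ.K)) =
        algebraMap σ.K σ.p₁.Completion ((τ : σ.K) - (m : σ.K) * (y + o)) := by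
      simp only [ξ, dif_pos]
      rw [← map_sub, ← map_mul]
      congr 1
      field_simp
      ring
    rw [h2, hnorm, p₁_apply] at h1
    push_cast at h1 ⊢
    rw [abs_le] at h1 ⊢
    constructor <;> linarith [h1.1, h1.2]
  · rw [Prod.norm_def, max_le_iff, pi_norm_le_iff_of_nonneg (by positivity),
      pi_norm_le_iff_of_nonneg (by positivity)]
    constructor
    · intro w
      refine le_trans (le_of_eq ?_) ((hmain w.1).trans (le_add_of_nonneg_right zero_le_two))
      congr 1
      simp only [ξ, dif_neg w.2]
      change z.1 w - algebraMap σ.K w.1.Completion ((m : σ.K) * (y + o)) = _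
      have h3 : algebraMap σ.K w.1.Completion (m : σ.K) *
          algebraMap σ.K w.1.Completion (m : σ.K)⁻¹ = 1 := by
        rw [← map_mul, mul_inv_cancel₀ hm0', map_one]
      rw [map_mul, map_add]
      linear_combination -(z.1 w) * h3
    · intro 𝔭
      refine le_trans ?_ (le_add_of_nonneg_left (by positivity))
      change ‖z.2 𝔭 - algebraMap σ.K (𝔭.1.adicCompletion σ.K) ((m : σ.K) * (y + o))‖ ≤ 2
      have h3 : algebraMap σ.K (𝔭.1.adicCompletion σ.K) (m : σ.K) *
          algebraMap σ.K (𝔭.1.adicCompletion σ.K) (m : σ.K)⁻¹ = 1 := by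
        rw [← map_mul, mul_inv_cancel₀ hm0', map_one]
      have h4 : z.2 𝔭 - algebraMap σ.K (𝔭.1.adicCompletion σ.K) ((m : σ.K) * (y + o)) =
          algebraMap σ.K (𝔭.1.adicCompletion σ.K) (m : σ.K) *
            ((z.2 𝔭 * algebraMap σ.K (𝔭.1.adicCompletion σ.K) (m : σ.K)⁻¹ -
              algebraMap σ.K (𝔭.1.adicCompletion σ.K) y) -
              algebraMap σ.K (𝔭.1.adicCompletion σ.K) (o : σ.K)) := by
        rw [map_mul, map_add]
        linear_combination -(z.2 𝔭) * h3
      have h5 : ‖algebraMap σ.K (𝔭.1.adicCompletion σ.K) (m : σ.K)‖ ≤ 1 := by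
        have := FinitePlace.norm_le_one σ.K 𝔭.1 (m : 𝓞 σ.K)
        rwa [map_natCast] at this
      have h6 : ‖algebraMap σ.K (𝔭.1.adicCompletion σ.K) (o : σ.K)‖ ≤ 1 :=
        FinitePlace.norm_le_one σ.K 𝔭.1 o
      rw [h4, norm_mul]
      refine (mul_le_mul h5 ((norm_sub_le _ _).trans (add_le_add (hr 𝔭) h6))
        (norm_nonneg _) zero_le_one).trans ?_
      norm_num

/-! ### The `(σ, a)`-integers -/

theorem δ_append (p q : List A) : σ.δ v (p ++ q) = σ.δ v p + σ.δ v q := by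
  simp [δ, List.count_append, add_mul, Finset.sum_add_distrib]

@[simp]
theorem δ_nil : σ.δ v [] = 0 := by simp [δ]

@[simp]
theorem δ_singleton (a : A) : σ.δ v [a] = v a := by
  simp [δ, List.count_singleton]

theorem mem_approxIntegers_zero {a : A} {x : σ.K} : x ∈ σ.approxIntegers v a 0 ↔ x = 0 := by
  constructor
  · rintro ⟨w, p, -, -, rfl⟩
    simp
  · rintro rfl
    exact ⟨fun _ => a, fun _ => [], rfl, by simp, by simp⟩

theorem mem_approxIntegers_succ {a : A} {k : ℕ} {x : σ.K} :
    x ∈ σ.approxIntegers v a (k + 1) ↔ ∃ b p, σ.PrefixEdge b p a ∧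
      ∃ y ∈ σ.approxIntegers v b k, x = σ.α * y + σ.δ v p := by
  constructor
  · rintro ⟨w, p, rfl, hw, rfl⟩
    refine ⟨w 1, p 0, hw 0 k.succ_pos, _, ⟨fun i => w (i + 1), fun i => p (i + 1), rfl,
      fun i hi => hw (i + 1) (Nat.succ_lt_succ hi), rfl⟩, ?_⟩
    rw [Finset.sum_range_succ', Finset.mul_sum, pow_zero, mul_one]
    congr 1
    refine Finset.sum_congr rfl fun i _ => ?_
    ring
  · rintro ⟨b, p, hp, y, ⟨w, q, rfl, hw, rfl⟩, rfl⟩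
    refine ⟨fun i => Nat.casesOn i a w, fun i => Nat.casesOn i p q, rfl, ?_, ?_⟩
    · rintro (_ | i) hi
      · exact hp
      · exact hw i (Nat.lt_of_succ_lt_succ hi)
    · rw [Finset.sum_range_succ', Finset.mul_sum, pow_zero, mul_one]
      congr 1
      refine Finset.sum_congr rfl fun i _ => ?_
      ring

theorem approxIntegers_subset_V (hv : σ.IsPositiveLeftEigenvector v) (k : ℕ) :
    ∀ a, ∀ x ∈ σ.approxIntegers v a k, x ∈ σ.V v := by
  induction k with
  | zero => intro a x hx; rw [mem_approxIntegers_zero] at hx; rw [hx]; exact zero_mem _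
  | succ k ih =>
    intro a x hx
    obtain ⟨b, p, -, y, hy, rfl⟩ := σ.mem_approxIntegers_succ.1 hx
    exact add_mem (σ.α_mul_mem_V hv (ih b y hy)) (σ.δ_mem_V p)

/-- For large `k` a non-empty leading prefix contributes more than `l`. So a small element has empty
leading prefixes, and dropping them does not change the sum. -/
theorem exists_forall_mem_approxIntegers (hv : σ.IsPositiveLeftEigenvector v) (l : ℝ) :
    ∃ k₀, ∀ k ≥ k₀, ∀ j ≥ k, ∀ a, ∀ x ∈ σ.approxIntegers v a j, (x : ℝ) ≤ l →
      x ∈ σ.approxIntegers v a k := by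
  have hpos := hv.2
  have h1 : 1 < σ.root := σ.root_pisot.one_lt
  obtain ⟨c, hc0, hc⟩ : ∃ c : ℝ, 0 < c ∧ ∀ b, c ≤ (v b : ℝ) := by
    have := σ.nonempty_alphabet
    obtain ⟨b, hb⟩ := Finite.exists_min fun b => (v b : ℝ)
    exact ⟨_, hpos b, hb⟩
  obtain ⟨k₀, hk₀⟩ := pow_unbounded_of_one_lt (l / c) h1
  have key : ∀ k ≥ k₀, ∀ a, ∀ x ∈ σ.approxIntegers v a (k + 1), (x : ℝ) ≤ l →
      x ∈ σ.approxIntegers v a k := by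
    rintro k hk a x ⟨w, p, h0, hw, rfl⟩ hx
    have hnil : p k = [] := by
      by_contra hne
      obtain ⟨b, hb⟩ := List.exists_mem_of_ne_nil _ hne
      have hle := (hc b).trans (σ.le_δ hpos hb)
      have hpow : l / c < σ.root ^ k := hk₀.trans_le (pow_le_pow_right₀ h1.le hk)
      rw [div_lt_iff₀ hc0] at hpow
      rw [Finset.sum_range_succ] at hx
      push_cast at hx
      rw [coe_α] at hx
      have hsum : (0 : ℝ) ≤ ∑ i ∈ Finset.range k, (σ.δ v (p i) : ℝ) * σ.root ^ i :=
        Finset.sum_nonneg fun i _ => mul_nonneg (σ.δ_nonneg hpos _) (by positivity)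
      have : σ.root ^ k * c ≤ (σ.δ v (p k) : ℝ) * σ.root ^ k := by
        rw [mul_comm]; exact mul_le_mul_of_nonneg_right hle (by positivity)
      linarith
    refine ⟨w, p, h0, fun i hi => hw i (hi.trans k.lt_succ_self), ?_⟩
    simp [Finset.sum_range_succ, hnil]
  refine ⟨k₀, fun k hk j hj => ?_⟩
  induction j, hj using Nat.le_induction with
  | base => exact fun a x hx _ => hx
  | succ j hj ih => exact fun a x hx hl => ih a x (key j (le_trans hk hj) a x hx hl) hl

theorem eventually_mem_approxIntegers (hv : σ.IsPositiveLeftEigenvector v) {a : A} {x : σ.K}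
    (hx : x ∈ σ.sigmaIntegers v a) : ∀ᶠ k in atTop, x ∈ σ.approxIntegers v a k := by
  obtain ⟨k₀, hk₀⟩ := σ.exists_forall_mem_approxIntegers hv ((x : ℝ) + 1)
  set F : Set ℝ := (fun y : σ.K => (y : ℝ)) '' σ.approxIntegers v a k₀ \ {(x : ℝ)}
  have hF : F.Finite := ((σ.finite_approxIntegers k₀ a).image _).sdiff
  -- This neighbourhood isolates `x` from the other candidates, of which there are finitely many.
  have hU : Set.Iio ((x : ℝ) + 1) ∩ Fᶜ ∈ 𝓝 (x : ℝ) :=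
    inter_mem (Iio_mem_nhds (lt_add_one _)) (hF.isClosed.isOpen_compl.mem_nhds fun h => h.2 rfl)
  filter_upwards [hx _ hU, eventually_ge_atTop k₀] with k hk hkk
  obtain ⟨_, ⟨hlt, hnF⟩, y, hy, rfl⟩ := hk
  have hy0 := hk₀ k₀ le_rfl k hkk a y hy (le_of_lt hlt)
  have hyx : (y : ℝ) = x := by
    by_contra h
    exact hnF ⟨⟨y, hy0, rfl⟩, h⟩
  rwa [← Subtype.ext hyx]

theorem mem_sigmaIntegers_of_frequently (hv : σ.IsPositiveLeftEigenvector v) {a : A} {x : σ.K}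
    (hx : ∃ᶠ k in atTop, x ∈ σ.approxIntegers v a k) : x ∈ σ.sigmaIntegers v a := by
  have h1 : (x : ℝ) ∈ topologicalLimsup
      fun k => (fun y : σ.K => (y : ℝ)) '' σ.approxIntegers v a k :=
    fun U hU => hx.mono fun k hk => ⟨x, mem_of_mem_nhds hU, x, hk, rfl⟩
  rw [(σ.isTopologicalLimit_sigmaIntegers hv a).2] at h1
  obtain ⟨y, hy, hyx⟩ := h1
  rwa [← Subtype.ext hyx]

theorem α_mul_add_δ_mem_sigmaIntegers (hv : σ.IsPositiveLeftEigenvector v) {a b : A} {p : List A}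
    (hp : σ.PrefixEdge b p a) {y : σ.K} (hy : y ∈ σ.sigmaIntegers v b) :
    σ.α * y + σ.δ v p ∈ σ.sigmaIntegers v a := by
  refine σ.mem_sigmaIntegers_of_frequently hv
    ((tendsto_add_atTop_nat 1).frequently (Eventually.frequently ?_))
  filter_upwards [σ.eventually_mem_approxIntegers hv hy] with k hk
  exact σ.mem_approxIntegers_succ.2 ⟨b, p, hp, y, hk, rfl⟩

theorem finite_setOf_prefixEdge : {e : A × List A × A | σ.PrefixEdge e.1 e.2.1 e.2.2}.Finite := by
  refine (Set.finite_iUnion fun b : A => ((Set.finite_singleton b).prod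
    ((List.finite_toSet (σ.toFun b).inits).prod (Set.finite_univ (α := A))))).subset ?_
  rintro ⟨b, p, a⟩ ⟨s, hs⟩
  exact Set.mem_iUnion.2 ⟨b, rfl, (List.mem_inits _ _).2 ⟨_, hs.symm⟩, trivial⟩

/-- Pigeonhole: the last edge of the walk may vary with `k`, but there are finitely many edges, so
one of them occurs for infinitely many `k`. -/
theorem exists_eq_of_mem_sigmaIntegers (hv : σ.IsPositiveLeftEigenvector v) {a : A} {x : σ.K}
    (hx : x ∈ σ.sigmaIntegers v a) : ∃ b p, σ.PrefixEdge b p a ∧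
      ∃ y ∈ σ.sigmaIntegers v b, x = σ.α * y + σ.δ v p := by
  by_contra! hcon
  have h1 : ∀ᶠ k in atTop, ∀ e ∈ {e : A × List A × A | σ.PrefixEdge e.1 e.2.1 e.2.2},
      e.2.2 = a → σ.α⁻¹ * (x - σ.δ v e.2.1) ∉ σ.approxIntegers v e.1 k := by
    rw [eventually_all_finite σ.finite_setOf_prefixEdge]
    rintro ⟨b, p, a'⟩ he
    by_cases ha : a' = a
    swap
    · exact Eventually.of_forall fun k h => (ha h).elim
    subst ha
    by_contra hf
    refine hcon b p he (σ.α⁻¹ * (x - σ.δ v p))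
      (σ.mem_sigmaIntegers_of_frequently hv ((not_eventually.1 hf).mono fun k hk => ?_)) ?_
    · by_contra h; exact hk fun _ => h
    · rw [mul_inv_cancel_left₀ σ.α_ne_zero, sub_add_cancel]
  have h2 := (tendsto_add_atTop_nat 1).eventually (σ.eventually_mem_approxIntegers hv hx)
  obtain ⟨k, hk1, hk2⟩ := (h1.and h2).exists
  obtain ⟨b, p, hp, y, hy, rfl⟩ := σ.mem_approxIntegers_succ.1 hk2
  refine hk1 (b, p, a) hp rfl ?_
  rwa [add_sub_cancel_right, inv_mul_cancel_left₀ σ.α_ne_zero]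

/-! ### The greedy decomposition -/

theorem exists_prefix (w : List A) :
    ∀ x : ℝ, 0 ≤ x → x < σ.δ v w → ∃ p a s, w = p ++ a :: s ∧ (σ.δ v p : ℝ) ≤ x ∧
      x < σ.δ v p + v a := by
  induction w with
  | nil => intro x h0 h1; simp at h1; linarith
  | cons b w ih =>
    intro x h0 h1
    have hb : σ.δ v (b :: w) = v b + σ.δ v w := by
      rw [← List.singleton_append, δ_append, δ_singleton]
    rcases lt_or_ge x (v b) with h | h
    · exact ⟨[], b, w, rfl, by simpa using h0, by simpa using h⟩
    · rw [hb] at h1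
      push_cast at h1
      obtain ⟨p, a, s, rfl, h2, h3⟩ := ih (x - v b) (by linarith) (by linarith)
      refine ⟨b :: p, a, s, rfl, ?_⟩
      have hp : σ.δ v (b :: p) = v b + σ.δ v p := by
        rw [← List.singleton_append, δ_append, δ_singleton]
      rw [hp]
      push_cast
      constructor <;> linarith

/-- The letters of `σ^k(b)`, laid out with lengths `v_a`, tile an interval of length `α^k v_b`; the
left endpoints of the pieces are elements of `approxIntegers`. -/
theorem exists_approxIntegers_le (hv : σ.IsPositiveLeftEigenvector v) (b : A) (k : ℕ) :
    ∀ x : ℝ, 0 ≤ x → x < σ.root ^ k * v b →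
      ∃ a, ∃ d ∈ σ.approxIntegers v a k, (d : ℝ) ≤ x ∧ x < d + v a := by
  have hα : 0 < σ.root := one_pos.trans σ.root_pisot.one_lt
  induction k with
  | zero =>
    intro x h0 h1
    exact ⟨b, 0, σ.mem_approxIntegers_zero.2 rfl, by simpa using h0, by simpa using h1⟩
  | succ k ih =>
    intro x h0 h1
    obtain ⟨c, d, hd, hd1, hd2⟩ := ih (x / σ.root) (by positivity) (by
      rw [div_lt_iff₀ hα]; rw [pow_succ] at h1; linarith)
    rw [le_div_iff₀ hα] at hd1
    rw [div_lt_iff₀ hα] at hd2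
    obtain ⟨p, a, s, hs, hp1, hp2⟩ := σ.exists_prefix (σ.toFun c) (x - σ.root * d)
      (by linarith) (by
        rw [σ.δ_flatMap hv]
        push_cast
        rw [coe_α]
        linarith)
    refine ⟨a, σ.α * d + σ.δ v p, σ.mem_approxIntegers_succ.2 ⟨c, p, ⟨s, hs⟩, d, hd, rfl⟩, ?_⟩
    push_cast
    rw [coe_α]
    constructor <;> linarith

theorem mem_Frac_iff {a : A} {x : σ.K} :
    x ∈ σ.Frac v a ↔ x ∈ σ.L v ∧ 0 ≤ (x : ℝ) ∧ (x : ℝ) < v a := by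
  rw [← σ.δ_singleton (v := v) a]
  exact Iff.rfl

/-- Integer and fractional part of `x`. Greedy expansions at all large levels use finitely many
candidates `d`, so one recurs infinitely often and lies in the limit. -/
theorem exists_sigmaIntegers_sub_mem_Frac (hv : σ.IsPositiveLeftEigenvector v) {x : σ.K}
    (hx : x ∈ σ.L v) (h0 : 0 ≤ (x : ℝ)) : ∃ a, ∃ d ∈ σ.sigmaIntegers v a, x - d ∈ σ.Frac v a := by
  obtain ⟨k₀, hk₀⟩ := σ.exists_forall_mem_approxIntegers hv (x : ℝ)
  by_contra! hcon
  have h1 : ∀ᶠ k in atTop, ∀ a, ∀ d ∈ σ.approxIntegers v a k₀, (d : ℝ) ≤ x → (x : ℝ) < d + v a →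
      d ∉ σ.approxIntegers v a k := by
    rw [eventually_all]
    intro a
    rw [eventually_all_finite (σ.finite_approxIntegers k₀ a)]
    intro d hd
    by_cases h : (d : ℝ) ≤ x ∧ (x : ℝ) < d + v a
    swap
    · exact Eventually.of_forall fun k h2 h3 => (h ⟨h2, h3⟩).elim
    have h2 : ¬ ∃ᶠ k in atTop, d ∈ σ.approxIntegers v a k := by
      intro hf
      refine hcon a d (σ.mem_sigmaIntegers_of_frequently hv hf) (σ.mem_Frac_iff.2 ⟨?_, ?_, ?_⟩)
      · exact sub_mem hx (σ.V_le_L (σ.approxIntegers_subset_V hv k₀ a d hd))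
      · push_cast; linarith [h.1]
      · push_cast; linarith [h.2]
    filter_upwards [not_frequently.1 h2] with k hk _ _
    exact hk
  obtain ⟨b⟩ := σ.nonempty_alphabet
  have h2 : ∀ᶠ k : ℕ in atTop, (x : ℝ) < σ.root ^ k * v b :=
    ((tendsto_pow_atTop_atTop_of_one_lt σ.root_pisot.one_lt).atTop_mul_const
      (hv.2 b)).eventually_gt_atTop _
  obtain ⟨k, ⟨hk1, hk2⟩, hk3⟩ := ((h1.and h2).and (eventually_ge_atTop k₀)).exists
  obtain ⟨a, d, hd, hd1, hd2⟩ := σ.exists_approxIntegers_le hv b k x h0 hk2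
  exact hk1 a d (hk₀ k₀ le_rfl k hk3 a d hd hd1) hd1 hd2 hd

/-! ### Irreducibility -/

theorem finrank_K (hσ : σ.IsIrreducible) : Module.finrank ℚ σ.K = Fintype.card A := by
  rw [IntermediateField.adjoin.finrank (σ.root_pisot.isIntegral.tower_top)]
  have hroot : Polynomial.aeval σ.root (σ.incidence.map (Int.cast : ℤ → ℚ)).charpoly = 0 := by
    have h1 := σ.root_dominant.1
    rw [Matrix.mem_spectrum_iff_isRoot_charpoly] at h1
    have h2 : σ.incidence.map (Int.cast : ℤ → ℂ) =
        (σ.incidence.map (Int.cast : ℤ → ℚ)).map (algebraMap ℚ ℂ) := by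
      ext i j; simp
    rw [h2, Matrix.charpoly_map, Polynomial.IsRoot, Polynomial.eval_map_algebraMap] at h1
    refine (algebraMap ℝ ℂ).injective ?_
    rw [map_zero, ← Polynomial.aeval_algebraMap_apply]
    exact h1
  rw [← minpoly.eq_of_irreducible_of_monic hσ hroot (Matrix.charpoly_monic _),
    Matrix.charpoly_natDegree_eq_dim]

/-- The `v_b` with `b` reachable from `a` span an `α`-stable subspace, hence `K`. Its dimension is
the size of the alphabet, so every letter is reachable. -/
theorem reflTransGen_prefixEdge (hσ : σ.IsIrreducible) (hv : σ.IsPositiveLeftEigenvector v)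
    (a b : A) : Relation.ReflTransGen (fun a b => ∃ p, σ.PrefixEdge a p b) a b := by
  set S : Set A := {b | Relation.ReflTransGen (fun a b => ∃ p, σ.PrefixEdge a p b) a b} with hS
  have haS : a ∈ S := Relation.ReflTransGen.refl
  have hv0 : v a ≠ 0 := by
    intro h
    have := hv.2 a
    rw [h] at this
    norm_num at this
  have htop : Submodule.span ℚ (v '' S) = ⊤ := by
    refine σ.eq_top_of_α_mul_mem (Submodule.subset_span ⟨a, haS, rfl⟩) hv0 ?_
    intro x hx
    induction hx using Submodule.span_induction with
    | mem x hx =>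
      obtain ⟨b, hb, rfl⟩ := hx
      rw [← σ.δ_flatMap hv]
      refine Submodule.sum_mem _ fun c _ => ?_
      rw [← nsmul_eq_mul]
      by_cases hc : c ∈ σ.toFun b
      · obtain ⟨p, s, hps⟩ := List.append_of_mem hc
        exact Submodule.smul_of_tower_mem _ _
          (Submodule.subset_span ⟨c, Relation.ReflTransGen.tail hb ⟨p, s, hps⟩, rfl⟩)
      · rw [List.count_eq_zero_of_not_mem hc, zero_smul]
        exact zero_mem _
    | zero => simp
    | add x y _ _ hx hy => rw [mul_add]; exact add_mem hx hy
    | smul n x _ hx => rw [mul_smul_comm]; exact Submodule.smul_mem _ _ hx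
  have hcard : Fintype.card A ≤ S.ncard := by
    classical
    have h1 := finrank_span_le_card (R := ℚ) (v '' S)
    rw [htop, finrank_top, σ.finrank_K hσ, ← Set.ncard_eq_toFinset_card'] at h1
    exact h1.trans (Set.ncard_image_le S.toFinite)
  have hSu : S = Set.univ := by
    refine Set.eq_of_subset_of_ncard_le (Set.subset_univ _) ?_
    rwa [Set.ncard_univ, Nat.card_eq_fintype_card]
  have hb : b ∈ S := hSu ▸ Set.mem_univ b
  exact hb

/-! ### Subtiles -/

theorem exists_norm_sigmaIntegers_le (hv : σ.IsPositiveLeftEigenvector v) :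
    ∃ B : ℝ, 0 ≤ B ∧ ∀ a, ∀ x ∈ σ.sigmaIntegers v a, ‖σ.Φ' x‖ ≤ B := by
  obtain ⟨D, hD⟩ := (σ.finite_setOf_prefixEdge.image
    fun e : A × List A × A => ‖σ.Φ' (σ.δ v e.2.1)‖).bddAbove
  have hq := σ.norm_Φ'_α_lt_one
  have hq' : 0 < 1 - ‖σ.Φ' σ.α‖ := sub_pos.2 hq
  -- The sum of the geometric series, that is, the fixed point of `B ↦ ‖Φ'(α)‖ B + |D|`.
  set B := |D| / (1 - ‖σ.Φ' σ.α‖) with hB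
  have hB0 : 0 ≤ B := by positivity
  have hBD : ‖σ.Φ' σ.α‖ * B + |D| = B := by
    rw [hB]; field_simp; ring
  have key : ∀ k a, ∀ x ∈ σ.approxIntegers v a k, ‖σ.Φ' x‖ ≤ B := by
    intro k
    induction k with
    | zero => intro a x hx; rw [mem_approxIntegers_zero] at hx; rwa [hx, map_zero, norm_zero]
    | succ k ih =>
      intro a x hx
      obtain ⟨b, p, hp, y, hy, rfl⟩ := σ.mem_approxIntegers_succ.1 hx
      have h1 : ‖σ.Φ' (σ.δ v p)‖ ≤ |D| :=
        (hD ⟨(b, p, a), hp, rfl⟩).trans (le_abs_self D)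
      rw [map_add, map_mul, ← hBD]
      refine (norm_add_le _ _).trans (add_le_add ((norm_mul_le _ _).trans ?_) h1)
      exact mul_le_mul_of_nonneg_left (ih b y hy) (norm_nonneg _)
  refine ⟨B, hB0, fun a x hx => ?_⟩
  obtain ⟨k, hk⟩ := (σ.eventually_mem_approxIntegers hv hx).exists
  exact key k a x hk

theorem exists_norm_subtile_le (hv : σ.IsPositiveLeftEigenvector v) :
    ∃ B : ℝ, 0 ≤ B ∧ ∀ a, ∀ z ∈ σ.subtile v a, ‖z‖ ≤ B := by
  obtain ⟨B, hB0, hB⟩ := σ.exists_norm_sigmaIntegers_le hv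
  refine ⟨B, hB0, fun a z hz => ?_⟩
  have h : σ.subtile v a ⊆ Metric.closedBall 0 B := by
    refine closure_minimal ?_ Metric.isClosed_closedBall
    rintro _ ⟨x, hx, rfl⟩
    exact mem_closedBall_zero_iff.2 (hB a x hx)
  exact mem_closedBall_zero_iff.1 (h hz)

theorem isCompact_subtile (hv : σ.IsPositiveLeftEigenvector v) (a : A) :
    IsCompact (σ.subtile v a) := by
  obtain ⟨B, hB0, hB⟩ := σ.exists_norm_subtile_le hv
  exact (isCompact_closedBall (0 : σ.RepSpace) B).of_isClosed_subset isClosed_closure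
    fun z hz => mem_closedBall_zero_iff.2 (hB a z hz)

theorem Φ'_α_inv_mul : σ.Φ' σ.α⁻¹ * σ.Φ' σ.α = 1 := by
  rw [← map_mul, inv_mul_cancel₀ σ.α_ne_zero, map_one]

theorem Φ'_α_mul_inv : σ.Φ' σ.α * σ.Φ' σ.α⁻¹ = 1 := by
  rw [← map_mul, mul_inv_cancel₀ σ.α_ne_zero, map_one]

/-- The similarity `z ↦ Φ'(α)^k z + d` of the representation space. -/
def similarity (k : ℕ) (d : σ.RepSpace) : σ.RepSpace ≃ₜ σ.RepSpace where
  toFun z := σ.Φ' σ.α ^ k * z + d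
  invFun z := σ.Φ' σ.α⁻¹ ^ k * (z - d)
  left_inv z := by
    change σ.Φ' σ.α⁻¹ ^ k * (σ.Φ' σ.α ^ k * z + d - d) = z
    rw [add_sub_cancel_right, ← mul_assoc, ← mul_pow, Φ'_α_inv_mul, one_pow, one_mul]
  right_inv z := by
    change σ.Φ' σ.α ^ k * (σ.Φ' σ.α⁻¹ ^ k * (z - d)) + d = z
    rw [← mul_assoc, ← mul_pow, Φ'_α_mul_inv, one_pow, one_mul, sub_add_cancel]
  continuous_toFun := by fun_prop
  continuous_invFun := by fun_prop

theorem similarity_apply (k : ℕ) (d z : σ.RepSpace) :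
    σ.similarity k d z = σ.Φ' σ.α ^ k * z + d := rfl

theorem similarity_mem_subtile (hv : σ.IsPositiveLeftEigenvector v) {a b : A} {p : List A}
    (hp : σ.PrefixEdge b p a) {z : σ.RepSpace} (hz : z ∈ σ.subtile v b) :
    σ.similarity 1 (σ.Φ' (σ.δ v p)) z ∈ σ.subtile v a := by
  have h : σ.subtile v b ⊆ σ.similarity 1 (σ.Φ' (σ.δ v p)) ⁻¹' σ.subtile v a := by
    refine closure_minimal ?_ (isClosed_closure.preimage (σ.similarity _ _).continuous)
    rintro _ ⟨x, hx, rfl⟩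
    refine subset_closure ⟨_, σ.α_mul_add_δ_mem_sigmaIntegers hv hp hx, ?_⟩
    rw [similarity_apply, map_add, map_mul, pow_one]
  exact h hz

/-- With `similarity_mem_subtile`, this is the graph-directed set equation: `R(a)` is the union of
`Φ'(α) R(b) + Φ'(δ(p))` over the edges from `b` to `a`. A finite union of closed sets is closed, so
the equation survives the closure. -/
theorem exists_similarity_of_mem_subtile (hv : σ.IsPositiveLeftEigenvector v) {a : A}
    {z : σ.RepSpace} (hz : z ∈ σ.subtile v a) : ∃ b p, σ.PrefixEdge b p a ∧
      ∃ z' ∈ σ.subtile v b, z = σ.similarity 1 (σ.Φ' (σ.δ v p)) z' := by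
  have hfin := σ.finite_setOf_prefixEdge.subset
    (fun e (he : σ.PrefixEdge e.1 e.2.1 e.2.2 ∧ e.2.2 = a) => he.1)
  have h : σ.subtile v a ⊆ ⋃ e ∈ {e : A × List A × A | σ.PrefixEdge e.1 e.2.1 e.2.2 ∧ e.2.2 = a},
      σ.similarity 1 (σ.Φ' (σ.δ v e.2.1)) '' σ.subtile v e.1 := by
    refine closure_minimal ?_ (hfin.isClosed_biUnion fun e _ =>
      (σ.similarity _ _).isClosedMap _ isClosed_closure)
    rintro _ ⟨x, hx, rfl⟩
    obtain ⟨b, p, hp, y, hy, rfl⟩ := σ.exists_eq_of_mem_sigmaIntegers hv hx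
    refine Set.mem_biUnion (x := (b, p, a)) ⟨hp, rfl⟩ ⟨_, subset_closure ⟨y, hy, rfl⟩, ?_⟩
    rw [similarity_apply, map_add, map_mul, pow_one]
  obtain ⟨⟨b, p, a'⟩, ⟨he, rfl⟩, z', hz', rfl⟩ := Set.mem_iUnion₂.1 (h hz)
  exact ⟨b, p, he, z', hz', rfl⟩

theorem exists_similarity_pow_of_mem_subtile (hv : σ.IsPositiveLeftEigenvector v) (k : ℕ) :
    ∀ {a : A} {z : σ.RepSpace}, z ∈ σ.subtile v a → ∃ b d, ∃ z' ∈ σ.subtile v b,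
      z = σ.similarity k d z' ∧ ∀ z'' ∈ σ.subtile v b, σ.similarity k d z'' ∈ σ.subtile v a := by
  induction k with
  | zero =>
    intro a z hz
    exact ⟨a, 0, z, hz, by simp [similarity_apply], fun z'' h => by simpa [similarity_apply]⟩
  | succ k ih =>
    intro a z hz
    obtain ⟨b, p, hp, z', hz', rfl⟩ := σ.exists_similarity_of_mem_subtile hv hz
    obtain ⟨c, d, z₁, hz₁, rfl, h⟩ := ih hz'
    have heq : ∀ y, σ.similarity (k + 1) (σ.Φ' σ.α * d + σ.Φ' (σ.δ v p)) y =
        σ.similarity 1 (σ.Φ' (σ.δ v p)) (σ.similarity k d y) := by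
      intro y
      simp only [similarity_apply]
      ring
    refine ⟨c, _, z₁, hz₁, (heq z₁).symm, fun y hy => ?_⟩
    rw [heq]
    exact σ.similarity_mem_subtile hv hp (h y hy)

/-! ### Covering -/

theorem exists_nonneg_mem_L_near (hv : σ.IsPositiveLeftEigenvector v) (z : σ.RepSpace) {ε : ℝ}
    (hε : 0 < ε) : ∃ x ∈ σ.L v, 0 ≤ (x : ℝ) ∧ ‖z - σ.Φ' x‖ < ε := by
  obtain ⟨c, hc0, hc⟩ := σ.exists_mem_L_near hv
  obtain ⟨n, hn0, hn⟩ : ∃ n : ℕ, 0 < n ∧ ‖σ.Φ' σ.α‖ ^ n * c < ε := by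
    have h := (tendsto_pow_atTop_nhds_zero_of_lt_one (norm_nonneg _)
      σ.norm_Φ'_α_lt_one).mul_const c
    rw [zero_mul] at h
    exact ((eventually_gt_atTop 0).and (h.eventually_lt_const hε)).exists
  -- Aiming at the real value `c` with error at most `c` forces `x ≥ 0`; multiplying by `α^n` then
  -- shrinks the error in `RepSpace`.
  obtain ⟨x, hxL, hx1, hx2⟩ := hc c (σ.Φ' σ.α⁻¹ ^ n * z)
  have hα : 0 < σ.root := one_pos.trans σ.root_pisot.one_lt
  have hpow : ∀ n : ℕ, σ.α ^ n * x ∈ σ.L v := by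
    intro n
    induction n with
    | zero => simpa
    | succ n ih => rw [pow_succ', mul_assoc, σ.α_mul_mem_L_iff hv]; exact ih
  refine ⟨σ.α ^ n * x, hpow n, ?_, ?_⟩
  · push_cast
    rw [coe_α]
    have := (abs_le.1 hx1).2
    exact mul_nonneg (by positivity) (by linarith)
  · have h1 : z - σ.Φ' (σ.α ^ n * x) = σ.Φ' σ.α ^ n * (σ.Φ' σ.α⁻¹ ^ n * z - σ.Φ' x) := by
      rw [mul_sub, ← mul_assoc, ← mul_pow, Φ'_α_mul_inv, one_pow, one_mul, map_mul, map_pow]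
    rw [h1]
    refine (norm_mul_le _ _).trans_lt (lt_of_le_of_lt ?_ hn)
    exact mul_le_mul (norm_pow_le' _ hn0) hx2 (norm_nonneg _) (by positivity)

theorem finite_setOf_Frac (hv : σ.IsPositiveLeftEigenvector v) (a : A) {R : ℝ} (hR : 0 ≤ R) :
    {y : σ.K | y ∈ σ.Frac v a ∧ ‖σ.Φ' y‖ ≤ R}.Finite := by
  refine (σ.finite_setOf_mem_L hv (v a) hR).subset ?_
  rintro y ⟨hy, hyR⟩
  rw [mem_Frac_iff] at hy
  exact ⟨hy.1, by rw [abs_of_nonneg hy.2.1]; exact hy.2.2.le, hyR⟩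

/-- Nonnegative elements of `L` have dense image and are covered by their integer and fractional
parts. Only finitely many translates come near `z`, so the covering passes to the limit. -/
theorem exists_mem_subtile_add (hv : σ.IsPositiveLeftEigenvector v) (z : σ.RepSpace) :
    ∃ a, ∃ y ∈ σ.Frac v a, z - σ.Φ' y ∈ σ.subtile v a := by
  obtain ⟨B, hB0, hB⟩ := σ.exists_norm_subtile_le hv
  set R := ‖z‖ + 1 + B with hR
  have hR0 : 0 ≤ R := by positivity
  set T : Set σ.RepSpace := ⋃ a, ⋃ y ∈ {y : σ.K | y ∈ σ.Frac v a ∧ ‖σ.Φ' y‖ ≤ R},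
    (fun u => u - σ.Φ' y) ⁻¹' σ.subtile v a with hT
  have hclosed : IsClosed T := by
    refine isClosed_iUnion_of_finite fun a => (σ.finite_setOf_Frac hv a hR0).isClosed_biUnion
      fun y _ => isClosed_closure.preimage (by fun_prop)
  have hzT : z ∈ closure T := by
    rw [Metric.mem_closure_iff]
    intro ε hε
    obtain ⟨x, hxL, hx0, hx⟩ := σ.exists_nonneg_mem_L_near hv z (lt_min hε one_pos)
    obtain ⟨a, d, hd, hxd⟩ := σ.exists_sigmaIntegers_sub_mem_Frac hv hxL hx0
    have hdt : σ.Φ' d ∈ σ.subtile v a := subset_closure ⟨d, hd, rfl⟩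
    refine ⟨σ.Φ' x, ?_, ?_⟩
    · refine Set.mem_iUnion.2 ⟨a, Set.mem_iUnion₂.2 ⟨x - d, ⟨hxd, ?_⟩, ?_⟩⟩
      · have h1 : σ.Φ' (x - d) = z - (z - σ.Φ' x) - σ.Φ' d := by rw [map_sub]; ring
        rw [h1]
        have h2 := norm_sub_le (z - (z - σ.Φ' x)) (σ.Φ' d)
        have h3 := norm_sub_le z (z - σ.Φ' x)
        have h4 := hB a _ hdt
        have h5 := hx.le.trans (min_le_right _ _)
        linarith
      · change σ.Φ' x - σ.Φ' (x - d) ∈ σ.subtile v a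
        rwa [map_sub, sub_sub_cancel]
    · rw [dist_eq_norm]
      exact hx.trans_le (min_le_left _ _)
  rw [hclosed.closure_eq] at hzT
  obtain ⟨a, ha⟩ := Set.mem_iUnion.1 hzT
  obtain ⟨y, hy, hyz⟩ := Set.mem_iUnion₂.1 ha
  exact ⟨a, y, hy.1, hyz⟩

/-! ### Interiors -/

theorem countable_K : Countable σ.K :=
  (Module.finBasis ℚ σ.K).equivFun.toEquiv.countable_iff.2 inferInstance

/-- Baire gives an interior point to one subtile, and the similarities along a path of the prefix
automaton carry it to `a`. -/
theorem interior_subtile_nonempty (hσ : σ.IsIrreducible) (hv : σ.IsPositiveLeftEigenvector v)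
    (a : A) : (interior (σ.subtile v a)).Nonempty := by
  have := σ.countable_K
  obtain ⟨⟨b, y⟩, hby⟩ : ∃ i : A × σ.K,
      (interior ((fun u => u - σ.Φ' i.2) ⁻¹' σ.subtile v i.1)).Nonempty := by
    refine nonempty_interior_of_iUnion_of_closed
      (fun i => isClosed_closure.preimage (by fun_prop)) ?_
    refine Set.eq_univ_of_forall fun z => ?_
    obtain ⟨a, y, -, h⟩ := σ.exists_mem_subtile_add hv z
    exact Set.mem_iUnion.2 ⟨(a, y), h⟩
  have hb : (interior (σ.subtile v b)).Nonempty := by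
    have h1 := (Homeomorph.subRight (σ.Φ' y)).preimage_interior (σ.subtile v b)
    obtain ⟨z, hz⟩ := hby
    refine ⟨z - σ.Φ' y, ?_⟩
    change z ∈ Homeomorph.subRight (σ.Φ' y) ⁻¹' interior (σ.subtile v b)
    rw [h1]
    exact hz
  induction σ.reflTransGen_prefixEdge hσ hv b a with
  | refl => exact hb
  | tail _ h ih =>
    obtain ⟨p, hp⟩ := h
    refine (ih.image (σ.similarity 1 (σ.Φ' (σ.δ v p)))).mono ?_
    refine interior_maximal ?_ ((σ.similarity _ _).isOpenMap _ isOpen_interior)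
    rintro _ ⟨z, hz, rfl⟩
    exact σ.similarity_mem_subtile hv hp (interior_subset hz)

theorem subtile_eq_closure_interior (hσ : σ.IsIrreducible) (hv : σ.IsPositiveLeftEigenvector v)
    (a : A) : σ.subtile v a = closure (interior (σ.subtile v a)) := by
  obtain ⟨B, hB0, hB⟩ := σ.exists_norm_subtile_le hv
  refine Set.Subset.antisymm (fun z hz => ?_) (closure_minimal interior_subset isClosed_closure)
  rw [Metric.mem_closure_iff]
  intro ε hε
  obtain ⟨n, hn0, hn⟩ : ∃ n : ℕ, 0 < n ∧ ‖σ.Φ' σ.α‖ ^ n * (B + B) < ε := by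
    have h := (tendsto_pow_atTop_nhds_zero_of_lt_one (norm_nonneg _)
      σ.norm_Φ'_α_lt_one).mul_const (B + B)
    rw [zero_mul] at h
    exact ((eventually_gt_atTop 0).and (h.eventually_lt_const hε)).exists
  obtain ⟨b, d, z', hz', rfl, h⟩ := σ.exists_similarity_pow_of_mem_subtile hv n hz
  -- The copy of `R(b)` at depth `n` around `z` has diameter below `ε` and contains an interior
  -- point.
  obtain ⟨u, hu⟩ := σ.interior_subtile_nonempty hσ hv b
  refine ⟨σ.similarity n d u, ?_, ?_⟩
  · refine (interior_maximal ?_ ((σ.similarity n d).isOpenMap _ isOpen_interior)) ⟨u, hu, rfl⟩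
    rintro _ ⟨y, hy, rfl⟩
    exact h y (interior_subset hy)
  · rw [dist_eq_norm, similarity_apply, similarity_apply, add_sub_add_right_eq_sub, ← mul_sub]
    refine (norm_mul_le _ _).trans_lt (lt_of_le_of_lt ?_ hn)
    refine mul_le_mul (norm_pow_le' _ hn0) ((norm_sub_le _ _).trans ?_) (norm_nonneg _)
      (by positivity)
    exact add_le_add (hB b _ hz') (hB b _ (interior_subset hu))

/-! ### The lattice -/

/-- The embedding `y ↦ (-y, Φ'(y))` of `K` into `ℝ × RepSpace`. -/
def latticeHom : σ.K →+ ℝ × σ.RepSpace where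
  toFun y := (-(y : ℝ), σ.Φ' y)
  map_zero' := by simp
  map_add' x y := by
    rw [map_add]
    refine Prod.ext ?_ rfl
    change -((x : ℝ) + y) = -(x : ℝ) + -(y : ℝ)
    ring

theorem latticeHom_apply (y : σ.K) : σ.latticeHom y = (-(y : ℝ), σ.Φ' y) := rfl

variable (v) in
/-- The lattice `{(-y, Φ'(y)) : y ∈ V · ℤ[α⁻¹]}`. -/
def lattice : AddSubgroup (ℝ × σ.RepSpace) := (σ.L v).toAddSubgroup.map σ.latticeHom

theorem mem_lattice {g : ℝ × σ.RepSpace} :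
    g ∈ σ.lattice v ↔ ∃ y ∈ σ.L v, σ.latticeHom y = g := Iff.rfl

theorem isClosed_lattice (hv : σ.IsPositiveLeftEigenvector v) :
    IsClosed (σ.lattice v : Set (ℝ × σ.RepSpace)) := by
  refine isClosed_of_closure_subset fun g hg => ?_
  have hfin : ((σ.lattice v : Set (ℝ × σ.RepSpace)) ∩ Metric.ball g 1).Finite := by
    refine ((σ.finite_setOf_mem_L hv (‖g‖ + 1)
      (B := ‖g‖ + 1) (by positivity)).image σ.latticeHom).subset ?_
    rintro _ ⟨⟨y, hy, rfl⟩, hyg⟩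
    have h1 : ‖σ.latticeHom y‖ ≤ ‖g‖ + 1 := by
      rw [mem_ball_iff_norm] at hyg
      have := norm_le_norm_add_norm_sub' (σ.latticeHom y) g
      linarith
    rw [latticeHom_apply, Prod.norm_def, max_le_iff, norm_neg] at h1
    exact ⟨y, ⟨hy, h1.1, h1.2⟩, rfl⟩
  have h2 : g ∈ closure ((σ.lattice v : Set (ℝ × σ.RepSpace)) ∩ Metric.ball g 1) := by
    rw [mem_closure_iff_nhds] at hg ⊢
    intro U hU
    obtain ⟨y, ⟨hyU, hyB⟩, hyL⟩ := hg _ (inter_mem hU (Metric.ball_mem_nhds g one_pos))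
    exact ⟨y, hyU, hyL, hyB⟩
  rw [hfin.isClosed.closure_eq] at h2
  exact h2.1

theorem compactSpace_quotient_lattice (hv : σ.IsPositiveLeftEigenvector v) :
    CompactSpace ((ℝ × σ.RepSpace) ⧸ σ.lattice v) := by
  obtain ⟨c, hc0, hc⟩ := σ.exists_mem_L_near hv
  have h := (isCompact_closedBall (0 : ℝ × σ.RepSpace) c).image
    (QuotientAddGroup.continuous_mk (N := σ.lattice v))
  refine ⟨h.of_isClosed_subset isClosed_univ ?_⟩
  intro q _
  obtain ⟨⟨t, z⟩, rfl⟩ := QuotientAddGroup.mk_surjective q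
  obtain ⟨y, hy, h1, h2⟩ := hc (-t) z
  refine ⟨(t, z) - σ.latticeHom y, ?_, ?_⟩
  · rw [mem_closedBall_zero_iff, latticeHom_apply, Prod.mk_sub_mk, Prod.norm_def, max_le_iff]
    refine ⟨?_, h2⟩
    rw [Real.norm_eq_abs, ← abs_neg]
    exact (congrArg abs (show -(t - -(y : ℝ)) = -t - y by ring)).trans_le h1
  · refine QuotientAddGroup.eq.2 (σ.mem_lattice.2 ⟨y, hy, ?_⟩)
    abel

variable (v) in
theorem inv_pow_mul_mem_L (hv : σ.IsPositiveLeftEigenvector v) (a : A) (n : ℕ) :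
    σ.α⁻¹ ^ n * v a ∈ σ.L v := by
  rw [σ.mem_L_iff hv]
  refine ⟨n, ?_⟩
  rw [← mul_assoc, ← mul_pow, mul_inv_cancel₀ σ.α_ne_zero, one_pow, one_mul]
  exact σ.v_mem_V a

/-- `L` contains the arbitrarily small positive numbers `α⁻ⁿ v_a` and their integer multiples. -/
theorem exists_mem_L_abs_sub_lt (hv : σ.IsPositiveLeftEigenvector v) (t : ℝ) {ε : ℝ} (hε : 0 < ε) :
    ∃ y ∈ σ.L v, |t - (y : ℝ)| < ε := by
  obtain ⟨a⟩ := σ.nonempty_alphabet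
  have h1 := σ.root_pisot.one_lt
  obtain ⟨n, hn⟩ : ∃ n : ℕ, σ.root⁻¹ ^ n * v a < ε := by
    have h := (tendsto_pow_atTop_nhds_zero_of_lt_one (inv_nonneg.2 (by linarith))
      (inv_lt_one_of_one_lt₀ h1)).mul_const (v a : ℝ)
    rw [zero_mul] at h
    exact (h.eventually_lt_const hε).exists
  have hη : 0 < σ.root⁻¹ ^ n * v a := mul_pos (by positivity) (hv.2 a)
  set η : ℝ := σ.root⁻¹ ^ n * v a
  refine ⟨⌊t / η⌋ • (σ.α⁻¹ ^ n * v a), Submodule.smul_mem _ _ (σ.inv_pow_mul_mem_L v hv a n), ?_⟩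
  have h2 : ((⌊t / η⌋ • (σ.α⁻¹ ^ n * v a) : σ.K) : ℝ) = ⌊t / η⌋ * η := by
    rw [zsmul_eq_mul]
    push_cast
    rw [coe_α]
  rw [h2]
  have h3 := Int.floor_le (t / η)
  have h4 := Int.lt_floor_add_one (t / η)
  rw [le_div_iff₀ hη] at h3
  rw [div_lt_iff₀ hη] at h4
  rw [abs_lt]
  constructor <;> linarith

/-- The only danger is an empty product of completions. Then the bounded infinite set of the `α⁻ⁿ
v_a` would contradict discreteness of `L`. -/
theorem Φ'_injective (hv : σ.IsPositiveLeftEigenvector v) : Function.Injective σ.Φ' := by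
  have : Nontrivial σ.RepSpace := by
    by_contra h
    rw [not_nontrivial_iff_subsingleton] at h
    obtain ⟨a⟩ := σ.nonempty_alphabet
    have h1 := σ.root_pisot.one_lt
    refine Set.infinite_of_injective_forall_mem (f := fun n : ℕ => σ.α⁻¹ ^ n * v a) ?_ (fun n => ?_)
      (σ.finite_setOf_mem_L hv (v a) le_rfl)
    · intro m n hmn
      have h2 : σ.root⁻¹ ^ m * (v a : ℝ) = σ.root⁻¹ ^ n * (v a : ℝ) := by
        have := congrArg (fun x : σ.K => (x : ℝ)) hmn
        push_cast at this
        rwa [coe_α] at this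
      exact pow_right_injective₀ (by positivity) (inv_lt_one_of_one_lt₀ h1).ne
        (mul_right_cancel₀ (hv.2 a).ne' h2)
    · refine ⟨σ.inv_pow_mul_mem_L v hv a n, ?_, ?_⟩
      · push_cast
        rw [coe_α, abs_of_nonneg (mul_nonneg (by positivity) (hv.2 a).le)]
        exact mul_le_of_le_one_left (hv.2 a).le
          (pow_le_one₀ (by positivity) (inv_lt_one_of_one_lt₀ h1).le)
      · rw [Subsingleton.elim (σ.Φ' _) 0, norm_zero]
  exact σ.Φ'.injective

/-- Multiplication by `α` on `ℝ × RepSpace`. -/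
def mulα : ℝ × σ.RepSpace →+ ℝ × σ.RepSpace where
  toFun g := (σ.root * g.1, σ.Φ' σ.α * g.2)
  map_zero' := by simp
  map_add' x y := by simp [mul_add]

theorem mulα_apply (g : ℝ × σ.RepSpace) : σ.mulα g = (σ.root * g.1, σ.Φ' σ.α * g.2) := rfl

theorem continuous_mulα : Continuous σ.mulα := by
  change Continuous fun g : ℝ × σ.RepSpace => (σ.root * g.1, σ.Φ' σ.α * g.2)
  fun_prop

theorem mulα_surjective : Function.Surjective σ.mulα := by
  intro g
  refine ⟨(σ.root⁻¹ * g.1, σ.Φ' σ.α⁻¹ * g.2), ?_⟩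
  have h : σ.root ≠ 0 := (one_pos.trans σ.root_pisot.one_lt).ne'
  rw [mulα_apply, ← mul_assoc, ← mul_assoc, Φ'_α_mul_inv, mul_inv_cancel₀ h, one_mul, one_mul]

theorem mulα_latticeHom (y : σ.K) : σ.mulα (σ.latticeHom y) = σ.latticeHom (σ.α * y) := by
  rw [mulα_apply, latticeHom_apply, latticeHom_apply, map_mul]
  push_cast
  rw [coe_α, mul_neg]

theorem iterate_mulα (n : ℕ) (g : ℝ × σ.RepSpace) :
    σ.mulα^[n] g = (σ.root ^ n * g.1, σ.Φ' σ.α ^ n * g.2) := by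
  induction n with
  | zero => simp
  | succ n ih => rw [Function.iterate_succ_apply', ih, mulα_apply, pow_succ', pow_succ', mul_assoc,
      mul_assoc]

theorem tendsto_iterate_mulα (z : σ.RepSpace) :
    Tendsto (fun n => σ.mulα^[n] (0, z)) atTop (𝓝 0) := by
  simp_rw [iterate_mulα, mul_zero]
  refine tendsto_const_nhds.prodMk_nhds ?_
  have := (tendsto_pow_atTop_nhds_zero_of_norm_lt_one σ.norm_Φ'_α_lt_one).mul_const z
  rwa [zero_mul] at this

/-! ### The multiplicity function -/

variable (v) in
/-- The indices of the sets `[0, v_a) × R(a) + (-y, Φ'(y))` containing a given point. -/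
def indices (g : ℝ × σ.RepSpace) : Set (A × σ.K) :=
  {i | i.2 ∈ σ.L v ∧ (0 ≤ g.1 + i.2 ∧ g.1 + i.2 < v i.1) ∧ g.2 - σ.Φ' i.2 ∈ σ.subtile v i.1}

theorem exists_finite_indices_subset (hv : σ.IsPositiveLeftEigenvector v) (z : σ.RepSpace) (R : ℝ) :
    ∃ F : Set (A × σ.K), F.Finite ∧ ∀ t : ℝ, |t| ≤ R → σ.indices v (t, z) ⊆ F := by
  obtain ⟨B, hB0, hB⟩ := σ.exists_norm_subtile_le hv
  refine ⟨⋃ a : A, (Prod.mk a) '' {y : σ.K | y ∈ σ.L v ∧ |(y : ℝ)| ≤ R + v a ∧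
    ‖σ.Φ' y‖ ≤ ‖z‖ + B}, Set.finite_iUnion fun a =>
      (σ.finite_setOf_mem_L hv _ (by positivity)).image _, ?_⟩
  rintro t ht ⟨a, y⟩ ⟨h1, ⟨h2, h3⟩, h4⟩
  refine Set.mem_iUnion.2 ⟨a, y, ⟨h1, ?_, ?_⟩, rfl⟩
  · simp only at h2 h3
    rw [abs_le] at ht ⊢
    have := hv.2 a
    constructor <;> linarith [ht.1, ht.2]
  · have h5 := norm_sub_le z (z - σ.Φ' y)
    rw [sub_sub_cancel] at h5
    exact h5.trans (by linarith [hB a _ h4])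

theorem finite_indices (hv : σ.IsPositiveLeftEigenvector v) (g : ℝ × σ.RepSpace) :
    (σ.indices v g).Finite := by
  obtain ⟨F, hF, h⟩ := σ.exists_finite_indices_subset hv g.2 |g.1|
  exact hF.subset (h g.1 le_rfl)

theorem ncard_indices_add (hv : σ.IsPositiveLeftEigenvector v) (g : ℝ × σ.RepSpace)
    {l : ℝ × σ.RepSpace} (hl : l ∈ σ.lattice v) :
    (σ.indices v g).ncard ≤ (σ.indices v (g + l)).ncard := by
  obtain ⟨x, hx, rfl⟩ := σ.mem_lattice.1 hl
  refine Set.ncard_le_ncard_of_injOn (fun i => (i.1, i.2 + x)) ?_ ?_ (σ.finite_indices hv _)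
  · rintro ⟨a, y⟩ ⟨h1, h2, h3⟩
    refine ⟨add_mem h1 hx, ?_, ?_⟩
    · have : (g + σ.latticeHom x).1 + ((y + x : σ.K) : ℝ) = g.1 + y := by
        rw [latticeHom_apply, Prod.fst_add]
        push_cast
        ring
      simp only [this]
      exact h2
    · have : (g + σ.latticeHom x).2 - σ.Φ' (y + x) = g.2 - σ.Φ' y := by
        rw [latticeHom_apply, Prod.snd_add, map_add]
        ring
      simp only [this]
      exact h3
  · rintro ⟨a, y⟩ _ ⟨b, y'⟩ _ h
    simpa using h

/-- The intervals `[δ(p), δ(p) + v_b)` attached to the positions of a word are disjoint. -/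
theorem eq_of_prefix_of_lt (hpos : ∀ a, 0 < (v a : ℝ)) {p p' s s' : List A} {b b' : A}
    (h : p ++ b :: s = p' ++ b' :: s') {x : ℝ} (h1 : (σ.δ v p : ℝ) ≤ x)
    (h2 : x < σ.δ v p + v b) (h1' : (σ.δ v p' : ℝ) ≤ x) (h2' : x < σ.δ v p' + v b') :
    p = p' ∧ b = b' := by
  have key : ∀ {p c : List A} {b : A}, (σ.δ v (p ++ b :: c) : ℝ) ≥ σ.δ v p + v b := by
    intro p c b
    rw [δ_append, ← List.singleton_append, δ_append, δ_singleton]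
    push_cast
    linarith [σ.δ_nonneg hpos c]
  rw [List.append_eq_append_iff] at h
  rcases h with ⟨c, rfl, hc⟩ | ⟨c, rfl, hc⟩
  · rcases c with _ | ⟨d, c⟩
    · simp at hc
      simp [hc.1]
    · rw [List.cons_append, List.cons.injEq] at hc
      rw [← hc.1] at h1'
      linarith [key (p := p) (c := c) (b := b)]
  · rcases c with _ | ⟨d, c⟩
    · simp at hc
      simp [hc.1]
    · rw [List.cons_append, List.cons.injEq] at hc
      rw [← hc.1] at h1
      linarith [key (p := p') (c := c) (b := b')]

/-- If the box `(a, y)` contains `αg`, the set equation gives an edge from some `b` to `a` with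
prefix `p`, and then the box `(b, α⁻¹(y + δ(p)))` contains `g`. -/
theorem ncard_indices_mulα_le (hv : σ.IsPositiveLeftEigenvector v) (g : ℝ × σ.RepSpace) :
    (σ.indices v (σ.mulα g)).ncard ≤ (σ.indices v g).ncard := by
  have hα : 0 < σ.root := one_pos.trans σ.root_pisot.one_lt
  have hex : ∀ i : A × σ.K, ∃ e : A × List A, i ∈ σ.indices v (σ.mulα g) →
      σ.PrefixEdge e.1 e.2 i.1 ∧ ∃ z' ∈ σ.subtile v e.1,
        σ.Φ' σ.α * g.2 - σ.Φ' i.2 = σ.similarity 1 (σ.Φ' (σ.δ v e.2)) z' := by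
    intro i
    by_cases hi : i ∈ σ.indices v (σ.mulα g)
    · obtain ⟨b, p, hp, z', hz', h⟩ := σ.exists_similarity_of_mem_subtile hv hi.2.2
      exact ⟨(b, p), fun _ => ⟨hp, z', hz', h⟩⟩
    · exact ⟨(i.1, []), fun h => (hi h).elim⟩
  choose e he using hex
  have hcoe : ∀ x : σ.K, ((σ.α⁻¹ * x : σ.K) : ℝ) = σ.root⁻¹ * x := by
    intro x
    push_cast
    rw [coe_α]
  refine Set.ncard_le_ncard_of_injOn (fun i => ((e i).1, σ.α⁻¹ * (i.2 + σ.δ v (e i).2)))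
    ?_ ?_ (σ.finite_indices hv _)
  · intro i hi
    obtain ⟨⟨s, hs⟩, z', hz', h⟩ := he i hi
    obtain ⟨h1, ⟨h2, h3⟩, -⟩ := hi
    rw [mulα_apply] at h2 h3
    simp only at h2 h3
    have h4 := σ.δ_nonneg hv.2 (e i).2
    have h5 : σ.root * v (e i).1 ≥ σ.δ v (e i).2 + v i.1 := by
      have := congrArg (fun x : σ.K => (x : ℝ)) (σ.δ_flatMap hv (e i).1)
      rw [hs, δ_append, ← List.singleton_append, δ_append, δ_singleton] at this
      push_cast at this
      rw [coe_α] at this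
      linarith [σ.δ_nonneg hv.2 s]
    refine ⟨?_, ⟨?_, ?_⟩, ?_⟩
    · rw [← σ.α_mul_mem_L_iff hv, mul_inv_cancel_left₀ σ.α_ne_zero]
      exact add_mem h1 (σ.V_le_L (σ.δ_mem_V _))
    · rw [hcoe]
      have : 0 ≤ σ.root * (g.1 + σ.root⁻¹ * ((i.2 + σ.δ v (e i).2 : σ.K) : ℝ)) := by
        rw [mul_add, mul_inv_cancel_left₀ hα.ne']
        push_cast
        linarith
      exact nonneg_of_mul_nonneg_right this hα
    · rw [hcoe]
      refine lt_of_mul_lt_mul_left ?_ hα.le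
      rw [mul_add, mul_inv_cancel_left₀ hα.ne']
      push_cast
      linarith
    · convert hz' using 1
      rw [similarity_apply, pow_one] at h
      have h6 : σ.Φ' σ.α * z' = σ.Φ' σ.α * g.2 - σ.Φ' (i.2 + σ.δ v (e i).2) := by
        rw [map_add]
        linear_combination -h
      rw [map_mul]
      linear_combination (-σ.Φ' σ.α⁻¹) * h6 + (z' - g.2) * σ.Φ'_α_inv_mul
  -- Injectivity: the target box fixes `b` and the real number `αg₁ + y + δ(p)`, whose position
  -- inside `σ(b)` determines `p` and `a`.
  · intro i hi j hj hij
    obtain ⟨⟨s, hs⟩, -⟩ := he i hi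
    obtain ⟨⟨s', hs'⟩, -⟩ := he j hj
    obtain ⟨-, ⟨h2, h3⟩, -⟩ := hi
    obtain ⟨-, ⟨h2', h3'⟩, -⟩ := hj
    simp only [Prod.mk.injEq] at hij
    have h4 := mul_left_cancel₀ (inv_ne_zero σ.α_ne_zero) hij.2
    have h5 := congrArg (fun x : σ.K => (x : ℝ)) h4
    push_cast at h5
    rw [hij.1, hs'] at hs
    obtain ⟨h6, h7⟩ := σ.eq_of_prefix_of_lt hv.2 hs.symm
      (x := (σ.mulα g).1 + i.2 + σ.δ v (e i).2) (by linarith) (by linarith) (by linarith)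
      (by linarith)
    rw [h6] at h4
    exact Prod.ext h7 (add_right_cancel h4)

theorem measurableSet_le_ncard_indices (hv : σ.IsPositiveLeftEigenvector v)
    [MeasurableSpace σ.RepSpace] [BorelSpace σ.RepSpace] (n : ℕ) :
    MeasurableSet {g : ℝ × σ.RepSpace | n ≤ (σ.indices v g).ncard} := by
  have := σ.countable_K
  have h1 : {g : ℝ × σ.RepSpace | n ≤ (σ.indices v g).ncard} =
      ⋃ s ∈ {s : Finset (A × σ.K) | s.card = n}, ⋂ i ∈ s, {g | i ∈ σ.indices v g} := by
    ext g
    simp only [Set.mem_ofPred_eq, Set.mem_iUnion, Set.mem_iInter, exists_prop]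
    constructor
    · intro hn
      obtain ⟨t, ht, htn⟩ := Set.exists_subset_card_eq hn
      have htf := (σ.finite_indices hv g).subset ht
      refine ⟨htf.toFinset, ?_, fun i hi => ht (htf.mem_toFinset.1 hi)⟩
      rw [← Set.ncard_eq_toFinset_card t htf, htn]
    · rintro ⟨s, rfl, hs⟩
      rw [← Set.ncard_coe_finset]
      exact Set.ncard_le_ncard hs (σ.finite_indices hv g)
  rw [h1]
  refine MeasurableSet.biUnion (Set.to_countable _) fun s _ =>
    Finset.measurableSet_biInter s fun i _ => ?_
  by_cases hi : i.2 ∈ σ.L v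
  · have h2 : {g : ℝ × σ.RepSpace | i ∈ σ.indices v g} =
        ((fun g : ℝ × σ.RepSpace => g.1 + i.2) ⁻¹' Set.Ico 0 (v i.1 : ℝ)) ∩
        ((fun g : ℝ × σ.RepSpace => g.2 - σ.Φ' i.2) ⁻¹' σ.subtile v i.1) := by
      ext g
      exact and_iff_right hi
    rw [h2]
    refine MeasurableSet.inter ?_ ?_
    · exact (measurable_fst.add_const _) measurableSet_Ico
    · exact IsClosed.measurableSet isClosed_closure |>.preimage (measurable_snd.sub_const _)
  · convert MeasurableSet.empty
    ext g
    exact iff_of_false (fun h => hi h.1) (Set.notMem_empty g)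

/-! ### Restriction to the slice `t = 0` and conclusion -/

/-- The intervals `[0, v_a)` are closed on the left and open on the right, so membership is constant
just to the right of `0`; only finitely many indices are involved. -/
theorem eventually_indices_eq (hv : σ.IsPositiveLeftEigenvector v) (z : σ.RepSpace) :
    ∀ᶠ t in 𝓝[≥] (0 : ℝ), σ.indices v (t, z) = σ.indices v (0, z) := by
  obtain ⟨F, hF, hFs⟩ := σ.exists_finite_indices_subset hv z 1
  have h1 : ∀ᶠ t in 𝓝[≥] (0 : ℝ), ∀ i ∈ F, (i ∈ σ.indices v (t, z) ↔ i ∈ σ.indices v (0, z)) := by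
    rw [eventually_all_finite hF]
    rintro ⟨a, y⟩ -
    have h2 : ∀ᶠ t in 𝓝[≥] (0 : ℝ), (0 ≤ t + (y : ℝ) ↔ 0 ≤ 0 + (y : ℝ)) := by
      rcases lt_or_ge (y : ℝ) 0 with h | h
      · filter_upwards [mem_nhdsWithin_of_mem_nhds (Iio_mem_nhds (neg_pos.2 h))] with t ht
        have : t < -(y : ℝ) := ht
        constructor <;> intro <;> linarith
      · filter_upwards [self_mem_nhdsWithin] with t ht
        have : 0 ≤ t := ht
        constructor <;> intro <;> linarith
    have h3 : ∀ᶠ t in 𝓝[≥] (0 : ℝ), (t + (y : ℝ) < v a ↔ 0 + (y : ℝ) < v a) := by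
      rcases lt_or_ge (y : ℝ) (v a) with h | h
      · filter_upwards [mem_nhdsWithin_of_mem_nhds (Iio_mem_nhds (sub_pos.2 h))] with t ht
        have : t < (v a : ℝ) - y := ht
        constructor <;> intro <;> linarith
      · filter_upwards [self_mem_nhdsWithin] with t ht
        have : 0 ≤ t := ht
        constructor <;> intro <;> linarith
    filter_upwards [h2, h3] with t ht2 ht3
    exact and_congr Iff.rfl (and_congr (and_congr ht2 ht3) Iff.rfl)
  filter_upwards [h1, self_mem_nhdsWithin, mem_nhdsWithin_of_mem_nhds (Iic_mem_nhds one_pos)]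
    with t ht ht0 ht1
  have habs : |t| ≤ 1 := abs_le.2 ⟨by linarith [show (0 : ℝ) ≤ t from ht0], ht1⟩
  ext i
  constructor
  · intro hi
    exact (ht i (hFs t habs hi)).1 hi
  · intro hi
    exact (ht i (hFs 0 (by simp) hi)).2 hi

theorem exists_ae_ncard_indices_eq (hv : σ.IsPositiveLeftEigenvector v)
    [MeasurableSpace σ.RepSpace] [BorelSpace σ.RepSpace]
    (μ : Measure σ.RepSpace) [μ.IsAddHaarMeasure] :
    ∃ m, ∀ᵐ z ∂μ, (σ.indices v (0, z)).ncard = m := by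
  have := σ.compactSpace_quotient_lattice hv
  obtain ⟨m, hm⟩ := exists_ae_eq_of_forall_null_or_conull
    (μ := (volume : Measure ℝ).prod μ) (fun g => (σ.indices v g).ncard) (fun n => by
    refine null_or_conull_of_contracting_endomorphism (σ.lattice v) (σ.isClosed_lattice hv) σ.mulα
      σ.continuous_mulα σ.mulα_surjective ?_ (σ.measurableSet_le_ncard_indices hv n) ?_ ?_
      (H := {g | g.1 = 0}) ?_ ?_ _
    · rintro x hx
      obtain ⟨y, hy, rfl⟩ := σ.mem_lattice.1 hx
      exact σ.mem_lattice.2 ⟨_, (σ.α_mul_mem_L_iff hv).2 hy, (σ.mulα_latticeHom y).symm⟩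
    · intro g hg l hl
      exact le_trans hg (σ.ncard_indices_add hv g hl)
    · intro g hg
      exact le_trans hg (σ.ncard_indices_mulα_le hv g)
    · rintro ⟨t, z⟩ rfl
      exact σ.tendsto_iterate_mulα z
    · intro g
      rw [Metric.mem_closure_iff]
      intro ε hε
      obtain ⟨y, hy, hyε⟩ := σ.exists_mem_L_abs_sub_lt hv (-g.1) hε
      -- This point agrees with `g` in `RepSpace` and has real coordinate `-y`, close to that of
      -- `g`.
      refine ⟨(0, g.2 - σ.Φ' y) + σ.latticeHom y,
        ⟨_, rfl, _, σ.mem_lattice.2 ⟨y, hy, rfl⟩, rfl⟩, ?_⟩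
      rw [latticeHom_apply, Prod.mk_add_mk, sub_add_cancel, zero_add, Prod.dist_eq, dist_self,
        max_lt_iff]
      refine ⟨?_, hε⟩
      rw [Real.dist_eq, ← abs_neg]
      exact (congrArg abs (show -(g.1 - -(y : ℝ)) = -g.1 - y by ring)).trans_lt hyε)
  refine ⟨m, ?_⟩
  have h1 := Measure.ae_ae_of_ae_prod hm
  -- Fubini gives the constant on almost every slice only, and `t = 0` may be exceptional; hence
  -- good slices `t_n → 0⁺`.
  have h2 : ∀ n : ℕ, ∃ t : ℝ, (0 ≤ t ∧ t < 1 / ((n : ℝ) + 1)) ∧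
      ∀ᵐ z ∂μ, (σ.indices v (t, z)).ncard = m := by
    intro n
    by_contra! hne
    have h3 : volume (Set.Ico (0 : ℝ) (1 / ((n : ℝ) + 1))) = 0 :=
      measure_mono_null (fun t ht h => (not_eventually.2 (hne t ht)) h) (ae_iff.1 h1)
    rw [Real.volume_Ico, sub_zero, ENNReal.ofReal_eq_zero] at h3
    have : 0 < 1 / ((n : ℝ) + 1) := by positivity
    linarith
  choose t ht ht' using h2
  have hlim : Tendsto t atTop (𝓝[≥] 0) := by
    refine tendsto_nhdsWithin_iff.2 ⟨?_, Eventually.of_forall fun n => (ht n).1⟩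
    exact squeeze_zero (fun n => (ht n).1) (fun n => (ht n).2.le)
      tendsto_one_div_add_atTop_nhds_zero_nat
  filter_upwards [ae_all_iff.2 ht'] with z hz
  obtain ⟨n, hn⟩ := (hlim.eventually (σ.eventually_indices_eq hv z)).exists
  rw [← hn, hz n]

theorem indices_zero_nonempty (hv : σ.IsPositiveLeftEigenvector v) (z : σ.RepSpace) :
    (σ.indices v (0, z)).Nonempty := by
  obtain ⟨a, y, hy, hz⟩ := σ.exists_mem_subtile_add hv z
  rw [mem_Frac_iff] at hy
  exact ⟨(a, y), hy.1, by simpa using hy.2, hz⟩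

/-- At `t = 0` the condition on `y` is membership in `Frac`; injectivity of `Φ'` ensures that
indexing by `Φ'(y)` instead of `y` loses no multiplicity. -/
theorem encard_tile_eq (hv : σ.IsPositiveLeftEigenvector v) (z : σ.RepSpace) :
    {g : σ.Γ v | z ∈ σ.tile v g}.encard = (σ.indices v (0, z)).encard := by
  have hinj : Function.Injective fun i : A × σ.K => (σ.Φ' i.2, i.1) := by
    rintro ⟨a, x⟩ ⟨b, y⟩ h
    rw [Prod.mk.injEq] at h
    exact Prod.ext h.2 (σ.Φ'_injective hv h.1)
  rw [← hinj.encard_image, ← Subtype.val_injective.encard_image]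
  congr 1
  ext ⟨γ, a⟩
  constructor
  · rintro ⟨⟨⟨γ', a'⟩, x, hx, hγ⟩, ⟨u, hu, hux⟩, h⟩
    obtain ⟨rfl, rfl⟩ := Prod.mk.inj h
    simp only at hγ hux hu
    rw [mem_Frac_iff] at hx
    refine ⟨(a', x), ⟨hx.1, by simpa using hx.2, ?_⟩, Prod.ext hγ.symm rfl⟩
    rw [← hux, ← hγ, add_sub_cancel_right]
    exact hu
  · rintro ⟨⟨b, y⟩, ⟨h1, h2, h3⟩, h⟩
    obtain ⟨rfl, rfl⟩ := Prod.mk.inj h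
    refine ⟨⟨(σ.Φ' y, b), y, σ.mem_Frac_iff.2 ⟨h1, by simpa using h2⟩, rfl⟩,
      ⟨_, h3, sub_add_cancel _ _⟩, rfl⟩

end PisotSubstitution

end

theorem mainTheorem3 {A : Type*} [Fintype A] [DecidableEq A] (σ : PisotSubstitution A)
    (hσ : σ.IsIrreducible) (v : A → σ.K) (hv : σ.IsPositiveLeftEigenvector v)
    [MeasurableSpace σ.RepSpace] [BorelSpace σ.RepSpace]
    (μ : Measure σ.RepSpace) [μ.IsAddHaarMeasure] :
    IsMultipleTiling μ (σ.tile v) := by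
  refine ⟨fun g => ⟨?_, ?_⟩, ?_⟩
  · exact (σ.isCompact_subtile hv _).image (continuous_add_const _)
  · change Homeomorph.addRight g.1.1 '' _ = closure (interior (Homeomorph.addRight g.1.1 '' _))
    rw [← Homeomorph.image_interior, ← Homeomorph.image_closure,
      ← σ.subtile_eq_closure_interior hσ hv]
  · obtain ⟨m, hm⟩ := σ.exists_ae_ncard_indices_eq hv μ
    refine ⟨m, ?_, ?_⟩
    · obtain ⟨z, hz⟩ := hm.exists
      rw [← hz]
      exact (Set.ncard_pos (σ.finite_indices hv _)).2 (σ.indices_zero_nonempty hv z)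
    · filter_upwards [hm] with z hz
      rw [σ.encard_tile_eq hv, ← hz, (σ.finite_indices hv _).cast_ncard_eq]
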